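/- Let $\operatorname{Homeo}^+(\mathbb R)$ be the group of orientation-preserving homeomorphisms of $\mathbb R$, and for $f\in\operatorname{Homeo}^+(\mathbb R)$ put $\operatorname{supp} f=\{x : f(x)\neq x\}$. Thompson's group $F$ is the subgroup of $\operatorname{Homeo}^+(\mathbb R)$ generated by $a(x)=x+1$ and by the map $b$ with $b(x)=x$ for $x\le 0$, $b(x)=2x$ for $0<x<1$ and $b(x)=x+1$ for $x\ge 1$. For $n\ge 2$, an *$n$-chain group* is a subgroup of $\operatorname{Homeo}^+(\mathbb R)$ of the form $\langle f_1,\dots,f_n\rangle$ such that 1. the sets $J_i=\operatorname{supp} f_i$ are nonempty open (possibly unbounded) intervals; $J_i\cap J_k=\varnothing$ if $|i-k|>1$; for $1\le i<n$, $J_i\cap J_{i+1}$ is a nonempty proper subinterval of $J_i$ and of $J_{i+1}$, and the left endpoint of $J_i$ is smaller than that of $J_{i+1}$; 2. $f_i(t)\ge t$ for all $i$ and all $t\in\mathbb R$; 3. for $1\le i<n$, the group $\langle f_i,f_{i+1}\rangle$ is isomorphic to Thompson's group $F$. **Theorem.** Let $n\ge 3$. Then there exists an uncountable set $\mathcal G$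 of $n$-chain groups such that every $G\in\mathcal G$ is not finitely presentable and has a simple commutator subgroup $G'=[G,G]$, and such that $G'\not\cong H'$ for all distinct $G,H\in\mathcal G$. -/

import Mathlib

namespace ChainGroups

/-- `Homeo⁺(ℝ)`: the group, under composition, of orientation preserving (that is, strictly
increasing) homeomorphisms of the real line. -/
def HomeoPlus : Subgroup (ℝ ≃ₜ ℝ) where
  carrier := {f | StrictMono f}
  mul_mem' := fun {_ _} hf hg _ _ hxy => hf (hg hxy)
  one_mem' := strictMono_id
  inv_mem' := fun {f} hf x y hxy => by
    by_contra h
    have h1 : f (f⁻¹ y) ≤ f (f⁻¹ x) := StrictMono.monotone hf (not_lt.mp h)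
    have h2 : ∀ z, f (f⁻¹ z) = z := fun z => f.apply_symm_apply z
    rw [h2, h2] at h1
    exact absurd hxy (not_lt.mpr h1)

/-- The (open) support of a homeomorphism: the set of points that it moves. -/
def supp (f : HomeoPlus) : Set ℝ := {x | f.1 x ≠ x}

/-- The left endpoint of a set of reals (of interest for nonempty intervals), in `[-∞, ∞]`. -/
noncomputable def leftEnd (J : Set ℝ) : EReal := sInf ((fun x : ℝ => (x : EReal)) '' J)

/-- An `n`-chain of intervals: nonempty open, possibly unbounded, intervals `J i` such that `J i`
and `J k` are disjoint if `|i - k| > 1` and such that `J i ∩ J (i + 1)` is a nonempty proper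
subinterval of both `J i` and `J (i + 1)`. (An intersection of two intervals is order connected.) -/
structure IsChainOfIntervals {n : ℕ} (J : Fin n → Set ℝ) : Prop where
  nonempty : ∀ i, (J i).Nonempty
  isOpen : ∀ i, IsOpen (J i)
  ordConnected : ∀ i, (J i).OrdConnected
  disjoint : ∀ i k : Fin n, (i : ℕ) + 1 < k → J i ∩ J k = ∅
  inter_nonempty : ∀ i k : Fin n, (k : ℕ) = i + 1 → (J i ∩ J k).Nonempty
  inter_ssubset_left : ∀ i k : Fin n, (k : ℕ) = i + 1 → J i ∩ J k ⊂ J i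
  inter_ssubset_right : ∀ i k : Fin n, (k : ℕ) = i + 1 → J i ∩ J k ⊂ J k

/-- The generating families of `n`-prechain groups: `n ≥ 2`, the supports of the `f i` form a chain
of intervals whose left endpoints increase, and no `f i` moves a point to the left. -/
structure IsPrechainFamily {n : ℕ} (f : Fin n → HomeoPlus) : Prop where
  two_le : 2 ≤ n
  chain : IsChainOfIntervals fun i => supp (f i)
  leftEnd_lt : ∀ i k : Fin n, (k : ℕ) = i + 1 → leftEnd (supp (f i)) < leftEnd (supp (f k))
  le_apply : ∀ i t, t ≤ (f i).1 t

/-- The translation `x ↦ x + 1`. -/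
def thompsonA : HomeoPlus where
  val := Homeomorph.addRight 1
  property := fun x y h => by
    change x + 1 < y + 1
    linarith

/-- The homeomorphism `x ↦ x` for `x ≤ 0`, `x ↦ 2 x` for `0 < x < 1`, `x ↦ x + 1` for `1 ≤ x`. -/
noncomputable def thompsonB : HomeoPlus where
  val :=
    { toFun := fun x => if x ≤ 0 then x else if x < 1 then 2 * x else x + 1
      invFun := fun y => if y ≤ 0 then y else if y < 2 then y / 2 else y - 1
      left_inv := fun x => by
        dsimp only
        split_ifs <;> linarith
      right_inv := fun x => by
        dsimp only
        split_ifs <;> linarith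
      continuous_toFun := by
        have h : (fun x : ℝ => if x ≤ 0 then x else if x < 1 then 2 * x else x + 1)
            = fun x => max x (min (2 * x) (x + 1)) := by
          funext x
          split_ifs <;> grind
        rw [h]
        fun_prop
      continuous_invFun := by
        have h : (fun y : ℝ => if y ≤ 0 then y else if y < 2 then y / 2 else y - 1)
            = fun y => min y (max (y / 2) (y - 1)) := by
          funext y
          split_ifs <;> grind
        rw [h]
        fun_prop }
  property := fun x y h => by
    change (if x ≤ 0 then x else if x < 1 then 2 * x else x + 1)
      < (if y ≤ 0 then y else if y < 1 then 2 * y else y + 1)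
    split_ifs <;> linarith

/-- Thompson's group `F`, in its standard copy inside `Homeo⁺(ℝ)`. -/
noncomputable def thompsonF : Subgroup HomeoPlus := Subgroup.closure {thompsonA, thompsonB}

/-- `G ≤ Homeo⁺(ℝ)` is an `n`-chain group: it is generated by a family `f` as above, any two
consecutive members of which generate a copy of Thompson's group `F`. -/
def IsChainGroup (n : ℕ) (G : Subgroup HomeoPlus) : Prop :=
  ∃ f : Fin n → HomeoPlus, IsPrechainFamily f ∧ G = Subgroup.closure (Set.range f) ∧
    ∀ i k : Fin n, (k : ℕ) = i + 1 →
      Nonempty (Subgroup.closure {f i, f k} ≃* thompsonF)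

end ChainGroups

/-! For real e in (2, 3), let f_i be the piecewise linear bump on (e(i-1), ei+2), and let G_e be
generated by f_0, …, f_{n-1} (`bumpChainGroup`). Consecutive supports overlap in an interval of
length 2 whatever e is, and explicit conjugacies identify ⟨f_i, f_{i+1}⟩ with F
(`nonempty_closure_bump_bump_mulEquiv`), so G_e is a chain group.

Simplicity of G_e': its elements have compact support inside the open interval on which G_e acts,
and it compresses compact subintervals into arbitrary open ones. Higman's argument
(`isSimpleGroup_of_compressible`) then reduces simplicity to perfectness. Perfectness holds because
the generators commute in every metabelian quotient: their supports are disjoint, or they satisfy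
relations of F (`commute_of_thompson_relations`).

Rigidity: every dyadic q in (0, 2] is the image of 2 under a word w in f_0, f_1 that does not depend
on e. The support of w f_0 w⁻¹ ends at q and that of f_1⁻¹ f_2 f_1 begins at e - 1, so for q < 2 the
two commute exactly when q ≤ e - 1 (`commRel_iff`). These relations therefore determine e. The three
generators can be replaced by elements of G_e' that agree with them where it matters, so a triple in
G_e' encodes e (`exists_encodes`).

A countable group has countably many triples, hence is isomorphic to G_e' for countably many e only.
As there are countably many finite presentations, only countably many G_e are finitely presented.
Discarding these e and keeping one e per isomorphism class of G_e' leaves uncountably many groups.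
-/

open ChainGroups
open scoped commutatorElement Topology

/-! ### The action on the line. -/

/-- Evaluation makes `Homeo⁺(ℝ)` act on the line. -/
instance HomeoPlus.instMulAction : MulAction HomeoPlus ℝ where
  smul f x := f.1 x
  one_smul _ := rfl
  mul_smul _ _ _ := rfl

namespace HomeoPlus

theorem ext {f g : HomeoPlus} (h : ∀ x : ℝ, f • x = g • x) : f = g :=
  Subtype.ext (Homeomorph.ext h)

instance : FaithfulSMul HomeoPlus ℝ := ⟨ext⟩

theorem smul_strictMono (f : HomeoPlus) : StrictMono fun x : ℝ => f • x := f.2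

@[simp]
theorem smul_lt_smul (f : HomeoPlus) {x y : ℝ} : f • x < f • y ↔ x < y :=
  (smul_strictMono f).lt_iff_lt

@[simp]
theorem smul_le_smul (f : HomeoPlus) {x y : ℝ} : f • x ≤ f • y ↔ x ≤ y :=
  (smul_strictMono f).le_iff_le

theorem lt_smul_of_inv_smul_lt {f : HomeoPlus} {x y : ℝ} : f⁻¹ • x < y ↔ x < f • y := by
  rw [← smul_lt_smul f, smul_inv_smul]

theorem smul_lt_of_lt_inv_smul {f : HomeoPlus} {x y : ℝ} : x < f⁻¹ • y ↔ f • x < y := by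
  rw [← smul_lt_smul f, smul_inv_smul]

end HomeoPlus

/-! ### Abstract criteria for simplicity and for perfectness. -/

theorem inv_smul_eq_self {Γ X : Type*} [Group Γ] [MulAction Γ X] {g : Γ} {x : X} :
    g⁻¹ • x = x ↔ g • x = x := by
  rw [inv_smul_eq_iff, eq_comm]

/-- Elements of a faithful action that move no common point commute. -/
theorem commute_of_forall_smul_eq {Γ X : Type*} [Group Γ] [MulAction Γ X] [FaithfulSMul Γ X]
    {a b : Γ} (h : ∀ x : X, a • x = x ∨ b • x = x) : Commute a b := by
  refine eq_of_smul_eq_smul (α := X) fun x => ?_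
  rw [mul_smul, mul_smul]
  by_cases ha : a • x = x
  · by_cases hb : b • x = x
    · rw [hb, ha, hb]
    · rw [ha]
      rcases h (b • x) with h1 | h1
      · exact h1
      · exact absurd (smul_left_cancel b h1) hb
  · have hb : b • x = x := (h x).resolve_left ha
    rw [hb]
    rcases h (a • x) with h1 | h1
    · exact absurd (smul_left_cancel a h1) ha
    · exact h1.symm

theorem commutatorElement_mul_left_eq_of_commute {Γ : Type*} [Group Γ] {b c d : Γ}
    (h : Commute c d) : ⁅b * c, d⁆ = ⁅b, d⁆ := by
  have h1 : c * d * c⁻¹ = d := by rw [h.eq, mul_inv_cancel_right]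
  calc ⁅b * c, d⁆ = b * (c * d * c⁻¹) * b⁻¹ * d⁻¹ := by rw [commutatorElement_def]; group
    _ = ⁅b, d⁆ := by rw [h1, commutatorElement_def]

/-- A perfect group of increasing bijections of an interval whose elements have compact support,
and which can move any compact subinterval into any open one, is simple. -/
theorem isSimpleGroup_of_compressible {Γ : Type*} [Group Γ] [Nontrivial Γ] [MulAction Γ ℝ]
    [FaithfulSMul Γ ℝ] (hmono : ∀ g : Γ, StrictMono fun x : ℝ => g • x) (p q : ℝ)
    (hsupp : ∀ g : Γ, ∃ s t, p < s ∧ s ≤ t ∧ t < q ∧ ∀ x, x < s ∨ t < x → g • x = x)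
    (hco : ∀ s t u v, p < s → s ≤ t → t < q → p < u → u < v → v < q →
      ∃ g : Γ, u < g • s ∧ g • t < v)
    (hperf : commutator Γ = ⊤) : IsSimpleGroup Γ := by
  refine ⟨fun N hN => or_iff_not_imp_left.mpr fun hbot => ?_⟩
  obtain ⟨α, hαN, x, hx⟩ : ∃ α ∈ N, ∃ x : ℝ, x < α • x := by
    obtain ⟨α, hαN, hα⟩ : ∃ α ∈ N, α ≠ 1 := by
      by_contra! h
      exact hbot ((Subgroup.eq_bot_iff_forall N).mpr h)
    obtain ⟨x, hx⟩ : ∃ x : ℝ, α • x ≠ x := by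
      by_contra! h
      exact hα (eq_of_smul_eq_smul (α := ℝ) fun x => by rw [h, one_smul])
    rcases lt_or_gt_of_ne hx with h | h
    · refine ⟨α⁻¹, N.inv_mem hαN, α • x, ?_⟩
      rwa [inv_smul_smul]
    · exact ⟨α, hαN, x, h⟩
  obtain ⟨s₀, t₀, hs₀, hst₀, ht₀, hfix₀⟩ := hsupp α
  have hs₀x : s₀ ≤ x := by
    by_contra! h
    exact hx.ne' (hfix₀ x (Or.inl h))
  have hxt₀ : α • x ≤ t₀ := by
    by_contra! h
    exact hx.ne' (smul_left_cancel α (hfix₀ _ (Or.inr h)))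
  rw [← top_le_iff, ← hperf, commutator_def, Subgroup.commutator_le]
  intro β _ γ _
  obtain ⟨s₁, t₁, hs₁, hst₁, ht₁, hfix₁⟩ := hsupp β
  obtain ⟨s₂, t₂, hs₂, hst₂, ht₂, hfix₂⟩ := hsupp γ
  -- ρ squeezes the supports of both β and γ into (x, α x), an interval that α moves off itself.
  obtain ⟨ρ, hρs, hρt⟩ := hco (min s₁ s₂) (max t₁ t₂) x (α • x) (lt_min hs₁ hs₂)
    ((min_le_left _ _).trans (hst₁.trans (le_max_left _ _))) (max_lt ht₁ ht₂)
    (hs₀.trans_le hs₀x) hx (hxt₀.trans_lt ht₀)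
  have hlift : ∀ δ : Γ, (∀ y, y < min s₁ s₂ ∨ max t₁ t₂ < y → δ • y = y) →
      ∀ y, y ≤ x ∨ α • x ≤ y → (ρ * δ * ρ⁻¹) • y = y := by
    intro δ hδ y hy
    rw [mul_smul, mul_smul, smul_eq_iff_eq_inv_smul]
    refine hδ _ ?_
    rcases hy with hy | hy
    · left
      rw [← (hmono ρ).lt_iff_lt]
      simpa using hy.trans_lt hρs
    · right
      rw [← (hmono ρ).lt_iff_lt]
      simpa using hρt.trans_le hy
  have hβ := hlift β fun y hy => hfix₁ y
    (hy.imp (fun h => h.trans_le (min_le_left _ _)) fun h => (le_max_left _ _).trans_lt h)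
  have hγ := hlift γ fun y hy => hfix₂ y
    (hy.imp (fun h => h.trans_le (min_le_right _ _)) fun h => (le_max_right _ _).trans_lt h)
  set β' := ρ * β * ρ⁻¹
  set γ' := ρ * γ * ρ⁻¹
  -- The conjugate of β'⁻¹ by α lives above α x and γ' below it, so ⁅β', γ'⁆ = ⁅⁅β', α⁆, γ'⁆, which
  -- lies in N.
  have hε : Commute (α * β'⁻¹ * α⁻¹) γ' := by
    refine commute_of_forall_smul_eq (X := ℝ) fun y => ?_
    by_cases hy : y ≤ α • x
    · left
      rw [mul_smul, mul_smul, smul_eq_iff_eq_inv_smul, inv_smul_eq_self]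
      refine hβ _ (Or.inl ?_)
      rw [← (hmono α).le_iff_le]
      simpa using hy
    · exact Or.inr (hγ y (Or.inr (not_le.mp hy).le))
  have hδ : β' * (α * β'⁻¹ * α⁻¹) ∈ N := by
    have := N.mul_mem (hN.conj_mem α hαN β') (N.inv_mem hαN)
    simpa only [mul_assoc] using this
  have hβγ : ⁅β', γ'⁆ ∈ N := by
    rw [← commutatorElement_mul_left_eq_of_commute hε]
    have := N.mul_mem hδ (hN.conj_mem _ (N.inv_mem hδ) γ')
    simpa only [commutatorElement_def, mul_assoc] using this
  have := hN.conj_mem _ hβγ ρ⁻¹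
  have h2 : ρ⁻¹ * ⁅β', γ'⁆ * ρ⁻¹⁻¹ = ⁅β, γ⁆ := by
    simp only [β', γ', commutatorElement_def]
    group
  rwa [h2] at this

/-- Two elements satisfying the relations of Thompson's group commute if the group they live in is
metabelian. -/
theorem commute_of_thompson_relations {Q : Type*} [Group Q]
    (hQ : ∀ a b c d : Q, Commute ⁅a, b⁆ ⁅c, d⁆) {f g : Q}
    (h₁ : Commute f ((g * f) * g * (g * f)⁻¹))
    (h₂ : Commute f ((g * f) * ((g * f) * g * (g * f)⁻¹) * (g * f)⁻¹)) : Commute f g := by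
  -- X, g, x₂, x₃, x₄ play the first generators of the infinite presentation of F. An element
  -- commutes with f = g⁻¹ X exactly when g and X conjugate it alike.
  obtain ⟨X, rfl⟩ : ∃ X, f = g⁻¹ * X := ⟨g * f, by group⟩
  rw [mul_inv_cancel_left] at h₁ h₂
  obtain ⟨x₂, hx₂⟩ : ∃ x, x = X * g * X⁻¹ := ⟨_, rfl⟩
  obtain ⟨x₃, hx₃⟩ : ∃ x, x = X * x₂ * X⁻¹ := ⟨_, rfl⟩
  obtain ⟨x₄, hx₄⟩ : ∃ x, x = X * x₃ * X⁻¹ := ⟨_, rfl⟩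
  rw [← hx₂] at h₁ h₂
  rw [← hx₃] at h₂
  have conj_eq : ∀ y, Commute (g⁻¹ * X) y → g * y * g⁻¹ = X * y * X⁻¹ := by
    intro y hy
    have h3 : g⁻¹ * X * y = y * (g⁻¹ * X) := hy.eq
    calc g * y * g⁻¹ = g * (y * (g⁻¹ * X)) * X⁻¹ := by group
      _ = X * y * X⁻¹ := by rw [← h3]; group
  have e₂ : g * x₂ * g⁻¹ = x₃ := by rw [conj_eq _ h₁, hx₃]
  have e₃ : g * x₃ * g⁻¹ = x₄ := by rw [conj_eq _ h₂, hx₄]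
  have e₂₃ : x₂ * x₃ * x₂⁻¹ = x₄ := by
    calc x₂ * x₃ * x₂⁻¹ = X * (g * x₂ * g⁻¹) * X⁻¹ := by rw [hx₃, hx₂]; group
      _ = x₄ := by rw [e₂, hx₄]
  have hcomm : Commute (x₂ * g⁻¹) (x₄ * x₃⁻¹) := by
    have h1 : x₂ * g⁻¹ = ⁅X, g⁆ := by rw [hx₂, commutatorElement_def]
    have h3 : x₄ * x₃⁻¹ = ⁅X, x₃⁆ := by rw [hx₄, commutatorElement_def]
    rw [h1, h3]
    exact hQ _ _ _ _
  have h5 : x₂ * g⁻¹ * (x₄ * x₃⁻¹) = x₄ * x₃⁻¹ * (x₂ * g⁻¹) := hcomm.eq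
  have h6 : g⁻¹ * (x₄ * x₃⁻¹) * g = x₃ * x₂⁻¹ := by rw [← e₃, ← e₂]; group
  -- The commuting commutators collapse the relations to x₂ = x₃; conjugating back by X gives g = x₂
  -- = X g X⁻¹.
  have h7 : x₄ * x₂⁻¹ = x₄ * x₃⁻¹ := by
    calc x₄ * x₂⁻¹ = x₂ * (x₃ * x₂⁻¹) * x₂⁻¹ := by rw [← e₂₃]; group
      _ = (x₂ * g⁻¹ * (x₄ * x₃⁻¹)) * (g * x₂⁻¹) := by rw [← h6]; group
      _ = x₄ * x₃⁻¹ := by rw [h5]; group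
  have h8 : x₂ = x₃ := inv_injective (mul_left_cancel h7)
  have h9 : X * g * X⁻¹ = X * x₂ * X⁻¹ := by rw [← hx₂, ← hx₃, h8]
  have h10 : g = X * g * X⁻¹ := by
    rw [← hx₂]
    exact mul_left_cancel (mul_right_cancel h9)
  have h11 : Commute X g := by
    change X * g = g * X
    calc X * g = (X * g * X⁻¹) * X := by group
      _ = g * X := by rw [← h10]
  exact ((Commute.refl g).inv_left).mul_left h11

universe u

/-- If the generators of `G` commute pairwise modulo the second derived subgroup, then the
commutator subgroup of `G` is perfect. -/
theorem commutator_commutator_eq_top_of_generators {G : Type u} [Group G] (S : Set G)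
    (hS : Subgroup.closure S = ⊤)
    (hcomm : ∀ (Q : Type u) [Group Q], (∀ a b c d : Q, Commute ⁅a, b⁆ ⁅c, d⁆) →
      ∀ φ : G →* Q, ∀ x ∈ S, ∀ y ∈ S, Commute (φ x) (φ y)) :
    commutator (commutator G) = ⊤ := by
  have hQ : ∀ a b c d : G ⧸ derivedSeries G 2, Commute ⁅a, b⁆ ⁅c, d⁆ := by
    intro a b c d
    obtain ⟨a, rfl⟩ := QuotientGroup.mk_surjective a
    obtain ⟨b, rfl⟩ := QuotientGroup.mk_surjective b
    obtain ⟨c, rfl⟩ := QuotientGroup.mk_surjective c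
    obtain ⟨d, rfl⟩ := QuotientGroup.mk_surjective d
    rw [← commutatorElement_eq_one_iff_commute]
    refine (QuotientGroup.eq_one_iff (N := derivedSeries G 2) ⁅⁅a, b⁆, ⁅c, d⁆⁆).mpr ?_
    have h1 : ∀ a b : G, ⁅a, b⁆ ∈ derivedSeries G 1 := fun a b => by
      rw [derivedSeries_succ, derivedSeries_zero]
      exact Subgroup.commutator_mem_commutator (Subgroup.mem_top a) (Subgroup.mem_top b)
    exact Subgroup.commutator_mem_commutator (h1 a b) (h1 c d)
  have hgen := hcomm _ hQ (QuotientGroup.mk' (derivedSeries G 2))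
  have hall : ∀ x y : G, Commute (QuotientGroup.mk' (derivedSeries G 2) x)
      (QuotientGroup.mk' (derivedSeries G 2) y) := by
    intro x y
    have hx : x ∈ Subgroup.closure S := hS ▸ Subgroup.mem_top x
    have hy : y ∈ Subgroup.closure S := hS ▸ Subgroup.mem_top y
    induction hx, hy using Subgroup.closure_induction₂ with
    | mem x y hx hy => exact hgen x hx y hy
    | one_left x hx => rw [map_one]; exact Commute.one_left _
    | one_right x hx => rw [map_one]; exact Commute.one_right _
    | mul_left x y z hx hy hz h₁ h₂ => rw [map_mul]; exact h₁.mul_left h₂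
    | mul_right y z x hy hz hx h₁ h₂ => rw [map_mul]; exact h₁.mul_right h₂
    | inv_left x y hx hy h => rw [map_inv]; exact h.inv_left
    | inv_right x y hx hy h => rw [map_inv]; exact h.inv_right
  have hle : commutator G ≤ derivedSeries G 2 := by
    rw [commutator_def, Subgroup.commutator_le]
    intro x _ y _
    rw [← QuotientGroup.eq_one_iff]
    exact commutatorElement_eq_one_iff_commute.mpr (hall x y)
  have h2 : derivedSeries G 2 = ⁅commutator G, commutator G⁆ := by
    rw [derivedSeries_succ, derivedSeries_one]
  rw [h2] at hle
  have h3 : (commutator (commutator G)).map (commutator G).subtype =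
      ⁅commutator G, commutator G⁆ := by
    rw [commutator_def (commutator G), Subgroup.map_commutator, ← MonoidHom.range_eq_map,
      Subgroup.range_subtype]
  rw [← h3] at hle
  refine eq_top_iff.mpr fun x _ => ?_
  obtain ⟨y, hy, hyx⟩ := hle x.2
  rwa [← (commutator G).subtype_injective hyx]

/-! ### Conjugate pairs, bumps and copies of Thompson's group. -/

namespace HomeoPlus

/-- Otherwise the infimum of the orbit lies in [a, x]; g moves it down, hence sends nearby orbit
points below it. -/
theorem exists_pow_smul_lt {g : HomeoPlus} {a x : ℝ} (h : ∀ y, a ≤ y → y ≤ x → g • y < y) :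
    ∃ k : ℕ, g ^ k • x < a := by
  by_contra! hk
  set S := Set.range fun k : ℕ => g ^ k • x
  have hbdd : BddBelow S := ⟨a, by rintro _ ⟨k, rfl⟩; exact hk k⟩
  have hne : S.Nonempty := Set.range_nonempty _
  have ha : a ≤ sInf S := le_csInf hne (by rintro _ ⟨k, rfl⟩; exact hk k)
  have hx : sInf S ≤ x := csInf_le hbdd ⟨0, by simp⟩
  have hlt : sInf S < g⁻¹ • sInf S := by
    rw [smul_lt_of_lt_inv_smul]
    exact h _ ha hx
  obtain ⟨_, ⟨k, rfl⟩, hk'⟩ := exists_lt_of_csInf_lt hne hlt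
  rw [smul_lt_of_lt_inv_smul] at hk'
  refine hk'.not_ge (csInf_le hbdd ⟨k + 1, ?_⟩)
  simp only [pow_succ', mul_smul]

theorem exists_lt_pow_smul {g : HomeoPlus} {a x : ℝ} (h : ∀ y, x ≤ y → y ≤ a → y < g • y) :
    ∃ k : ℕ, a < g ^ k • x := by
  by_contra! hk
  set S := Set.range fun k : ℕ => g ^ k • x
  have hbdd : BddAbove S := ⟨a, by rintro _ ⟨k, rfl⟩; exact hk k⟩
  have hne : S.Nonempty := Set.range_nonempty _
  have ha : sSup S ≤ a := csSup_le hne (by rintro _ ⟨k, rfl⟩; exact hk k)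
  have hx : x ≤ sSup S := le_csSup hbdd ⟨0, by simp⟩
  have hlt : g⁻¹ • sSup S < sSup S := by
    rw [lt_smul_of_inv_smul_lt]
    exact h _ hx ha
  obtain ⟨_, ⟨k, rfl⟩, hk'⟩ := exists_lt_of_lt_csSup hne hlt
  rw [lt_smul_of_inv_smul_lt] at hk'
  refine hk'.not_ge (le_csSup hbdd ⟨k + 1, ?_⟩)
  simp only [pow_succ', mul_smul]

/-- The pairs `(u, v)` such that `u` is supported in `D` and `h` conjugates it to `v`. -/
def conjPairs (D : Set ℝ) (h : ℝ → ℝ) : Subgroup (HomeoPlus × HomeoPlus) where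
  carrier := {w | (∀ x, x ∉ D → w.1 • x = x) ∧ ∀ x ∈ D, h (w.1 • x) = w.2 • h x}
  one_mem' := ⟨fun _ _ => one_smul _ _, fun _ _ => by simp⟩
  mul_mem' := by
    rintro ⟨u, v⟩ ⟨u', v'⟩ ⟨h₁, h₂⟩ ⟨h₁', h₂'⟩
    refine ⟨fun x hx => ?_, fun x hx => ?_⟩
    · change (u * u') • x = x
      rw [mul_smul, h₁' x hx, h₁ x hx]
    · change h ((u * u') • x) = (v * v') • h x
      have hu : u' • x ∈ D := by
        by_contra hc
        exact hc ((smul_left_cancel u' (h₁' _ hc)).symm ▸ hx)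
      rw [mul_smul, mul_smul, h₂ _ hu, h₂' x hx]
  inv_mem' := by
    rintro ⟨u, v⟩ ⟨h₁, h₂⟩
    refine ⟨fun x hx => inv_smul_eq_self.mpr (h₁ x hx), fun x hx => ?_⟩
    change h (u⁻¹ • x) = v⁻¹ • h x
    have hu : u⁻¹ • x ∈ D := by
      by_contra hc
      have h3 := h₁ _ hc
      rw [smul_inv_smul] at h3
      exact hc (h3 ▸ hx)
    have h4 := h₂ _ hu
    rw [smul_inv_smul] at h4
    rw [h4, inv_smul_smul]

/-- Two pairs of homeomorphisms that are conjugate, away from common fixed points, by a bijection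
generate isomorphic groups. -/
theorem nonempty_closure_pair_mulEquiv {f g f' g' : HomeoPlus} {D : Set ℝ} {h : ℝ → ℝ}
    (hinj : Set.InjOn h D) (hsurj : ∀ y, ∃ x ∈ D, h x = y)
    (hf : ∀ x, x ∉ D → f • x = x) (hg : ∀ x, x ∉ D → g • x = x)
    (hff : ∀ x ∈ D, h (f • x) = f' • h x) (hgg : ∀ x ∈ D, h (g • x) = g' • h x) :
    Nonempty (Subgroup.closure {f, g} ≃* Subgroup.closure {f', g'}) := by
  -- K is the graph of the isomorphism: both projections are injective, since `h` determines each
  -- entry of a pair from the other.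
  set K := Subgroup.closure {((f, f') : HomeoPlus × HomeoPlus), (g, g')} with hK
  have hKle : K ≤ conjPairs D h := by
    rw [hK, Subgroup.closure_le]
    rintro _ (rfl | rfl)
    · exact ⟨hf, hff⟩
    · exact ⟨hg, hgg⟩
  have h1 : Subgroup.closure {f, g} = K.map (MonoidHom.fst _ _) := by
    rw [hK, MonoidHom.map_closure, Set.image_pair]
    rfl
  have h2 : Subgroup.closure {f', g'} = K.map (MonoidHom.snd _ _) := by
    rw [hK, MonoidHom.map_closure, Set.image_pair]
    rfl
  have hfst : Function.Injective ((MonoidHom.fst HomeoPlus HomeoPlus).comp K.subtype) := by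
    rw [injective_iff_map_eq_one]
    rintro ⟨⟨u, v⟩, huv⟩ (hu : u = 1)
    subst hu
    have hv : v = 1 := by
      refine HomeoPlus.ext fun y => ?_
      obtain ⟨x, hx, rfl⟩ := hsurj y
      have : h ((1 : HomeoPlus) • x) = v • h x := (hKle huv).2 x hx
      rw [← this, one_smul, one_smul]
    subst hv
    rfl
  have hsnd : Function.Injective ((MonoidHom.snd HomeoPlus HomeoPlus).comp K.subtype) := by
    rw [injective_iff_map_eq_one]
    rintro ⟨⟨u, v⟩, huv⟩ (hv : v = 1)
    subst hv
    have hu : u = 1 := by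
      refine HomeoPlus.ext fun x => ?_
      rw [one_smul]
      by_cases hx : x ∈ D
      · have h3 : h (u • x) = (1 : HomeoPlus) • h x := (hKle huv).2 x hx
        rw [one_smul] at h3
        refine hinj ?_ hx h3
        by_contra hc
        exact hc ((smul_left_cancel u ((hKle huv).1 _ hc)).symm ▸ hx)
      · exact (hKle huv).1 x hx
    subst hu
    rfl
  have e1 := MonoidHom.ofInjective hfst
  have e2 := MonoidHom.ofInjective hsnd
  rw [MonoidHom.range_comp, Subgroup.range_subtype] at e1 e2
  rw [h1, h2]
  exact ⟨e1.symm.trans e2⟩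

@[simp]
theorem thompsonA_smul (x : ℝ) : thompsonA • x = x + 1 := rfl

theorem thompsonB_smul (x : ℝ) : thompsonB • x = max x (min (2 * x) (x + 1)) := by
  change (if x ≤ 0 then x else if x < 1 then 2 * x else x + 1) = _
  split_ifs <;> grind

/-- The homeomorphism with support `(s, t)` which has slope `2` near `s`, slope `1 / 2` near `t`,
and translates by `1` in between. -/
noncomputable def bump (s t : ℝ) : HomeoPlus where
  val :=
    { toFun := fun x => max x (min (min (2 * x - s) (x + 1)) ((x + t) / 2))
      invFun := fun x => min x (max (max ((x + s) / 2) (x - 1)) (2 * x - t))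
      left_inv := fun x => by grind
      right_inv := fun x => by grind
      continuous_toFun := by fun_prop
      continuous_invFun := by fun_prop }
  property := fun x y h => by
    change max x (min (min (2 * x - s) (x + 1)) ((x + t) / 2))
      < max y (min (min (2 * y - s) (y + 1)) ((y + t) / 2))
    grind

theorem bump_smul (s t x : ℝ) :
    bump s t • x = max x (min (min (2 * x - s) (x + 1)) ((x + t) / 2)) := rfl

theorem bump_inv_smul (s t x : ℝ) :
    (bump s t)⁻¹ • x = min x (max (max ((x + s) / 2) (x - 1)) (2 * x - t)) := rfl

theorem bump_smul_of_le {s t x : ℝ} (h : x ≤ s) : bump s t • x = x := by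
  rw [bump_smul]
  grind

theorem bump_smul_of_ge {s t x : ℝ} (h : t ≤ x) : bump s t • x = x := by
  rw [bump_smul]
  grind

theorem lt_bump_smul {s t x : ℝ} (h : s < x) (h' : x < t) : x < bump s t • x := by
  rw [bump_smul]
  grind

theorem le_bump_smul (s t x : ℝ) : x ≤ bump s t • x := le_max_left _ _

theorem supp_bump (s t : ℝ) : supp (bump s t) = Set.Ioo s t := by
  ext x
  change bump s t • x ≠ x ↔ _
  constructor
  · intro h
    by_contra hc
    rw [Set.mem_Ioo, not_and_or, not_lt, not_lt] at hc
    exact h (hc.elim bump_smul_of_le bump_smul_of_ge)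
  · exact fun h => (lt_bump_smul h.1 h.2).ne'

/-- The bump agrees with `thompsonB` up to e. Iterating the bump backwards into that region and
`thompsonB` forwards as often conjugates the bump on (-∞, e + 2) to `thompsonB` on ℝ. This conjugacy
is the identity up to e, so it leaves f alone. -/
theorem nonempty_closure_bump_mulEquiv_thompsonB {f : HomeoPlus} (hf : ∀ x : ℝ, 2 ≤ x → f • x = x)
    {e : ℝ} (he : 2 ≤ e) :
    Nonempty (Subgroup.closure {f, bump 0 (e + 2)} ≃* Subgroup.closure {f, thompsonB}) := by
  set g := bump 0 (e + 2) with hg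
  have hgB : ∀ x : ℝ, x ≤ e → thompsonB • x = g • x := by
    intro x hx
    rw [thompsonB_smul, hg, bump_smul]
    grind
  have hgq : ∀ x : ℝ, x < e + 2 → ∀ k : ℕ, g ^ k • x < e + 2 := by
    intro x hx k
    induction k with
    | zero => simpa using hx
    | succ k ih =>
      rw [pow_succ', mul_smul, ← bump_smul_of_ge (s := 0) (le_refl (e + 2)), smul_lt_smul]
      exact ih
  have hex : ∀ x : ℝ, x < e + 2 → ∃ k : ℕ, g⁻¹ ^ k • x ≤ e := by
    intro x hx
    obtain ⟨k, hk⟩ := exists_pow_smul_lt (g := g⁻¹) (a := e) (x := x) fun y hy hyx => by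
      rw [lt_smul_of_inv_smul_lt]
      exact lt_bump_smul (by linarith) (by linarith)
    exact ⟨k, hk.le⟩
  have hexB : ∀ x : ℝ, ∃ k : ℕ, thompsonB⁻¹ ^ k • x ≤ e := by
    intro x
    obtain ⟨k, hk⟩ := exists_pow_smul_lt (g := thompsonB⁻¹) (a := e) (x := x) fun y hy hyx => by
      rw [lt_smul_of_inv_smul_lt, thompsonB_smul]
      grind
    exact ⟨k, hk.le⟩
  have hdown : ∀ x : ℝ, x ≤ e → g⁻¹ • x ≤ e := by
    intro x hx
    refine le_trans ?_ hx
    rw [← smul_le_smul g, smul_inv_smul]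
    exact le_bump_smul _ _ _
  have hstep : ∀ (x : ℝ) (k : ℕ), g⁻¹ ^ k • x ≤ e → ∀ j : ℕ,
      g⁻¹ ^ (k + j) • x ≤ e ∧
      (thompsonB ^ (k + j) * g⁻¹ ^ (k + j)) • x = (thompsonB ^ k * g⁻¹ ^ k) • x := by
    intro x k hk j
    induction j with
    | zero => exact ⟨hk, rfl⟩
    | succ j ih =>
      refine ⟨?_, ?_⟩
      · rw [← add_assoc, pow_succ', mul_smul]
        exact hdown _ ih.1
      · rw [← ih.2, ← add_assoc, pow_succ, pow_succ' g⁻¹, mul_smul, mul_smul, mul_smul, mul_smul,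
          hgB _ (hdown _ ih.1), smul_inv_smul]
  obtain ⟨h, hh⟩ : ∃ h : ℝ → ℝ, ∀ x < e + 2, ∀ k : ℕ, g⁻¹ ^ k • x ≤ e →
      h x = (thompsonB ^ k * g⁻¹ ^ k) • x := by
    choose! κ hκ using hex
    refine ⟨fun x => (thompsonB ^ κ x * g⁻¹ ^ κ x) • x, fun x hx k hk => ?_⟩
    change (thompsonB ^ κ x * g⁻¹ ^ κ x) • x = _
    rw [← (hstep x k hk (κ x)).2, ← (hstep x (κ x) (hκ x hx) k).2, add_comm]
  have hcommon : ∀ x < e + 2, ∀ y < e + 2, ∃ k : ℕ, h x = (thompsonB ^ k * g⁻¹ ^ k) • x ∧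
      h y = (thompsonB ^ k * g⁻¹ ^ k) • y := by
    intro x hx y hy
    obtain ⟨k, hk⟩ := hex x hx
    obtain ⟨l, hl⟩ := hex y hy
    refine ⟨k + l, hh x hx _ (hstep x k hk l).1, hh y hy _ ?_⟩
    rw [add_comm]
    exact (hstep y l hl k).1
  have hid : ∀ x ≤ e, h x = x := by
    intro x hx
    rw [hh x (by linarith) 0 (by simpa using hx)]
    simp
  refine nonempty_closure_pair_mulEquiv (D := Set.Iio (e + 2)) (h := h) ?_ ?_ ?_ ?_ ?_ ?_
  · intro x hx y hy hxy
    obtain ⟨k, h1, h2⟩ := hcommon x hx y hy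
    rw [h1, h2] at hxy
    exact smul_left_cancel _ hxy
  · intro y
    obtain ⟨k, hk⟩ := hexB y
    have h1 : g⁻¹ ^ k • g ^ k • thompsonB⁻¹ ^ k • y = thompsonB⁻¹ ^ k • y := by
      rw [inv_pow, inv_smul_smul]
    have h2 : g ^ k • thompsonB⁻¹ ^ k • y < e + 2 := hgq _ (by linarith) k
    refine ⟨_, h2, ?_⟩
    rw [hh _ h2 k (h1.le.trans hk), mul_smul, h1, inv_pow, smul_inv_smul]
  · intro x hx
    rw [Set.mem_Iio, not_lt] at hx
    exact hf x (by linarith)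
  · intro x hx
    rw [Set.mem_Iio, not_lt] at hx
    exact bump_smul_of_ge hx
  · intro x hx
    rcases lt_or_ge x 2 with hx2 | hx2
    · have h1 : f • x < 2 := by rwa [← hf 2 le_rfl, smul_lt_smul]
      rw [hid x (by linarith), hid _ (by linarith)]
    · obtain ⟨k, h1, h2⟩ := hcommon x hx 2 (by linarith)
      rw [hid 2 he] at h2
      rw [hf x hx2, hf]
      rw [h1, h2, smul_le_smul]
      exact hx2
  · intro x hx
    obtain ⟨k, hk⟩ := hex x hx
    have h1 : g • x < e + 2 := by simpa using hgq x hx 1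
    have h2 : g⁻¹ ^ (k + 1) • g • x = g⁻¹ ^ k • x := by
      rw [pow_succ, mul_smul, inv_smul_smul]
    rw [hh x hx k hk, hh (g • x) h1 (k + 1) (h2 ▸ hk), mul_smul, h2, pow_succ', mul_smul, mul_smul]

/-- Consecutive bumps which overlap in an interval of length `2` generate Thompson's group. -/
theorem nonempty_closure_bump_bump_mulEquiv {e : ℝ} (he : 2 ≤ e) (s : ℝ) :
    Nonempty (Subgroup.closure {bump (s - e) (s + 2), bump s (s + e + 2)} ≃* thompsonF) := by
  have hAB : ∀ x : ℝ, 2 ≤ x → (thompsonA * thompsonB⁻¹) • x = x := by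
    intro x hx
    have : thompsonB⁻¹ • x = x - 1 := by
      rw [inv_smul_eq_iff, thompsonB_smul]
      grind
    rw [mul_smul, this, thompsonA_smul, sub_add_cancel]
  obtain ⟨e₁⟩ : Nonempty (Subgroup.closure {bump (s - e) (s + 2), bump s (s + e + 2)} ≃*
      Subgroup.closure {bump (-e) 2, bump 0 (e + 2)}) := by
    refine nonempty_closure_pair_mulEquiv (D := Set.univ) (h := fun x => x - s) ?_ ?_ ?_ ?_ ?_ ?_
    · exact fun x _ y _ h => sub_left_injective h
    · exact fun y => ⟨y + s, trivial, by simp⟩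
    · exact fun x hx => absurd trivial hx
    · exact fun x hx => absurd trivial hx
    · intro x _
      simp only [bump_smul]
      grind
    · intro x _
      simp only [bump_smul]
      grind
  obtain ⟨e₂⟩ := nonempty_closure_bump_mulEquiv_thompsonB (f := bump (-e) 2)
    (fun x hx => bump_smul_of_ge hx) he
  -- The reflection x ↦ 2 - x turns the remaining bump into the inverse of one on (0, e + 2), so the
  -- previous lemma applies a second time.
  obtain ⟨e₃⟩ : Nonempty (Subgroup.closure {bump (-e) 2, thompsonB} ≃*
      Subgroup.closure {(bump 0 (e + 2))⁻¹, (thompsonA * thompsonB⁻¹)⁻¹}) := by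
    refine nonempty_closure_pair_mulEquiv (D := Set.univ) (h := fun x => 2 - x) ?_ ?_ ?_ ?_ ?_ ?_
    · exact fun x _ y _ h => sub_right_injective h
    · exact fun y => ⟨2 - y, trivial, by simp⟩
    · exact fun x hx => absurd trivial hx
    · exact fun x hx => absurd trivial hx
    · intro x _
      simp only [bump_smul, bump_inv_smul]
      grind
    · intro x _
      have h1 : thompsonB⁻¹ • (2 - thompsonB • x) = 1 - x := by
        rw [inv_smul_eq_iff, thompsonB_smul, thompsonB_smul]
        grind
      rw [eq_inv_smul_iff, mul_smul, h1, thompsonA_smul]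
      ring
  obtain ⟨e₄⟩ := nonempty_closure_bump_mulEquiv_thompsonB hAB he
  have h₃ : Subgroup.closure {(bump 0 (e + 2))⁻¹, (thompsonA * thompsonB⁻¹)⁻¹} =
      Subgroup.closure {thompsonA * thompsonB⁻¹, bump 0 (e + 2)} := by
    rw [← Subgroup.closure_inv, Set.inv_insert, Set.inv_singleton, inv_inv, inv_inv, Set.pair_comm]
  have h₄ : Subgroup.closure {thompsonA * thompsonB⁻¹, thompsonB} = thompsonF := by
    refine le_antisymm ?_ ?_ <;> rw [thompsonF, Subgroup.closure_le]
    · have hA : thompsonA ∈ Subgroup.closure {thompsonA, thompsonB} :=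
        Subgroup.subset_closure (by simp)
      have hB : thompsonB ∈ Subgroup.closure {thompsonA, thompsonB} :=
        Subgroup.subset_closure (by simp)
      rintro _ (rfl | rfl)
      · exact mul_mem hA (inv_mem hB)
      · exact hB
    · have hA : thompsonA * thompsonB⁻¹ ∈
          Subgroup.closure {thompsonA * thompsonB⁻¹, thompsonB} :=
        Subgroup.subset_closure (by simp)
      have hB : thompsonB ∈ Subgroup.closure {thompsonA * thompsonB⁻¹, thompsonB} :=
        Subgroup.subset_closure (by simp)
      rintro _ (rfl | rfl)
      · simpa using mul_mem hA hB
      · exact hB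
  rw [h₃] at e₃
  rw [h₄] at e₄
  exact ⟨e₁.trans (e₂.trans (e₃.trans e₄))⟩

/-! ### The chain groups. -/

/-- The generators of the chain groups: overlapping bumps at distance `e` from each other. -/
noncomputable def chainGen (e : ℝ) (i : ℕ) : HomeoPlus := bump (e * (i - 1)) (e * i + 2)

/-- The group generated by a chain of `n` bumps at distance `e` from each other. -/
noncomputable def bumpChainGroup (n : ℕ) (e : ℝ) : Subgroup HomeoPlus :=
  Subgroup.closure (Set.range fun i : Fin n => chainGen e i)

theorem leftEnd_Ioo {s t : ℝ} (h : s < t) : leftEnd (Set.Ioo s t) = s := by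
  refine le_antisymm ?_ ?_
  · refine le_of_forall_gt_imp_ge_of_dense fun c hc => ?_
    obtain ⟨x, hx, hxc⟩ := EReal.lt_iff_exists_real_btwn.mp (lt_min hc (EReal.coe_lt_coe h))
    rw [lt_min_iff] at hxc
    have hmem : x ∈ Set.Ioo s t :=
      ⟨EReal.coe_lt_coe_iff.mp hx, EReal.coe_lt_coe_iff.mp hxc.2⟩
    exact (sInf_le (Set.mem_image_of_mem _ hmem)).trans hxc.1.le
  · refine le_sInf ?_
    rintro _ ⟨x, hx, rfl⟩
    exact EReal.coe_le_coe hx.1.le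

theorem supp_chainGen (e : ℝ) (i : ℕ) :
    supp (chainGen e i) = Set.Ioo (e * (i - 1)) (e * i + 2) := supp_bump _ _

theorem isPrechainFamily_chainGen {n : ℕ} (hn : 2 ≤ n) {e : ℝ} (he : 2 ≤ e) :
    IsPrechainFamily fun i : Fin n => chainGen e i where
  two_le := hn
  chain :=
    { nonempty := fun i => by
        rw [supp_chainGen, Set.nonempty_Ioo]
        linarith
      isOpen := fun i => by
        rw [supp_chainGen]
        exact isOpen_Ioo
      ordConnected := fun i => by
        rw [supp_chainGen]
        exact Set.ordConnected_Ioo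
      disjoint := fun i k hik => by
        have h : (i : ℝ) + 2 ≤ (k : ℕ) := by exact_mod_cast hik
        rw [supp_chainGen, supp_chainGen, ← Set.disjoint_iff_inter_eq_empty,
          Set.disjoint_left]
        intro x hx hx'
        have := hx.2
        have := hx'.1
        nlinarith
      inter_nonempty := fun i k hik => by
        have h : e * ((k : ℕ) : ℝ) = e * i + e := by
          rw [hik]
          push_cast
          ring
        refine ⟨e * i + 1, ?_, ?_⟩ <;> rw [supp_chainGen] <;> constructor <;> linarith
      inter_ssubset_left := fun i k hik => by
        refine Set.ssubset_iff_subset_ne.mpr ⟨Set.inter_subset_left, fun h => ?_⟩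
        rw [Set.inter_eq_left, supp_chainGen, supp_chainGen] at h
        have h1 : e * i ∈ Set.Ioo (e * ((i : ℕ) - 1 : ℝ)) (e * (i : ℕ) + 2) := by
          constructor <;> linarith
        have h2 := (h h1).1
        simp only [hik] at h2
        push_cast at h2
        linarith
      inter_ssubset_right := fun i k hik => by
        refine Set.ssubset_iff_subset_ne.mpr ⟨Set.inter_subset_right, fun h => ?_⟩
        rw [Set.inter_eq_right, supp_chainGen, supp_chainGen] at h
        have h1 : e * i + 2 ∈ Set.Ioo (e * ((k : ℕ) - 1 : ℝ)) (e * (k : ℕ) + 2) := by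
          simp only [hik]
          constructor <;> push_cast <;> linarith
        exact absurd (h h1).2 (lt_irrefl _) }
  leftEnd_lt := fun i k hik => by
    rw [supp_chainGen, supp_chainGen, leftEnd_Ioo (by linarith), leftEnd_Ioo (by linarith),
      EReal.coe_lt_coe_iff, hik]
    push_cast
    linarith
  le_apply := fun _ _ => le_bump_smul _ _ _

theorem isChainGroup_bumpChainGroup {n : ℕ} (hn : 2 ≤ n) {e : ℝ} (he : 2 ≤ e) :
    IsChainGroup n (bumpChainGroup n e) := by
  refine ⟨_, isPrechainFamily_chainGen hn he, rfl, fun i k hik => ?_⟩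
  obtain ⟨φ⟩ := nonempty_closure_bump_bump_mulEquiv he (e * i)
  have h1 : bump (e * i - e) (e * i + 2) = chainGen e i := by
    rw [chainGen]
    ring_nf
  have h2 : bump (e * i) (e * i + e + 2) = chainGen e k := by
    rw [chainGen, hik]
    push_cast
    ring_nf
  rw [h1, h2] at φ
  exact ⟨φ⟩

theorem chainGen_mem {n : ℕ} (e : ℝ) {i : ℕ} (hi : i < n) : chainGen e i ∈ bumpChainGroup n e :=
  Subgroup.subset_closure ⟨⟨i, hi⟩, rfl⟩

theorem chainGen_zero_smul {e x : ℝ} (he : 2 ≤ e) (hx : 0 ≤ x) (hx' : x ≤ 2) :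
    chainGen e 0 • x = x / 2 + 1 := by
  rw [chainGen, bump_smul]
  push_cast
  grind

theorem chainGen_one_smul {e x : ℝ} (hx : 0 ≤ x) (hx' : x ≤ e) :
    chainGen e 1 • x = min (2 * x) (x + 1) := by
  rw [chainGen, bump_smul]
  push_cast
  grind

theorem chainGen_smul_of_le {e x : ℝ} {i : ℕ} (h : x ≤ e * (i - 1)) : chainGen e i • x = x :=
  bump_smul_of_le h

theorem chainGen_smul_of_ge {e x : ℝ} {i : ℕ} (h : e * i + 2 ≤ x) : chainGen e i • x = x :=
  bump_smul_of_ge h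

theorem lt_chainGen_smul {e x : ℝ} {i : ℕ} (h : e * (i - 1) < x) (h' : x < e * i + 2) :
    x < chainGen e i • x := lt_bump_smul h h'

/-! ### Dynamics on the interval (-e, e(n-1)+2): dense orbits and compression. -/

theorem smul_eq_of_mem_bumpChainGroup {n : ℕ} {e : ℝ} (he : 2 ≤ e) {g : HomeoPlus}
    (hg : g ∈ bumpChainGroup n e) {x : ℝ} (hx : x ≤ -e ∨ e * (n - 1) + 2 ≤ x) : g • x = x := by
  have hle : bumpChainGroup n e ≤ MulAction.stabilizer HomeoPlus x := by
    rw [bumpChainGroup, Subgroup.closure_le]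
    rintro _ ⟨i, rfl⟩
    rcases hx with hx | hx
    · refine chainGen_smul_of_le ?_
      have : (0 : ℝ) ≤ (i : ℕ) := Nat.cast_nonneg _
      nlinarith
    · refine chainGen_smul_of_ge ?_
      have : ((i : ℕ) : ℝ) + 1 ≤ n := by exact_mod_cast i.2
      nlinarith
  exact hle hg

theorem mem_Ioo_smul_of_mem_bumpChainGroup {n : ℕ} {e : ℝ} (he : 2 ≤ e) {g : HomeoPlus}
    (hg : g ∈ bumpChainGroup n e) {x : ℝ} (hx : -e < x) (hx' : x < e * (n - 1) + 2) :
    -e < g • x ∧ g • x < e * (n - 1) + 2 := by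
  constructor
  · rwa [← smul_eq_of_mem_bumpChainGroup he hg (Or.inl le_rfl), smul_lt_smul]
  · rwa [← smul_eq_of_mem_bumpChainGroup he hg (Or.inr le_rfl), smul_lt_smul]

theorem exists_mem_Ioo_chainGen {n : ℕ} {e x : ℝ} (hn : n ≠ 0) (hx : -e < x)
    (hx' : x < e * (n - 1) + 2) : ∃ i < n, e * (i - 1) < x ∧ x < e * i + 2 := by
  have key : ∀ m : ℕ, x < e * m + 2 → ∃ i < m + 1, e * ((i : ℝ) - 1) < x ∧ x < e * i + 2 := by
    intro m
    induction m with
    | zero => exact fun h => ⟨0, one_pos, by push_cast; linarith, h⟩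
    | succ m ih =>
      intro h
      rcases lt_or_ge (e * m) x with h1 | h1
      · refine ⟨m + 1, Nat.lt_succ_self _, ?_, h⟩
        push_cast
        linarith
      · obtain ⟨i, hi, h2⟩ := ih (by linarith)
        exact ⟨i, hi.trans (Nat.lt_succ_self _), h2⟩
  obtain ⟨m, rfl⟩ := Nat.exists_eq_succ_of_ne_zero hn
  refine key m ?_
  push_cast at hx'
  linarith

/-- The supports cover the interval, so at an interior infimum of the orbit some inverse generator
would push orbit points below it. -/
theorem exists_smul_lt_of_bumpChainGroup {n : ℕ} (hn : n ≠ 0) {e x u : ℝ} (hu : -e < u)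
    (hx' : x < e * (n - 1) + 2) : ∃ g ∈ bumpChainGroup n e, g • x < u := by
  by_contra! h
  set S := (fun g : HomeoPlus => g • x) '' (bumpChainGroup n e : Set HomeoPlus)
  have hlow : ∀ y ∈ S, u ≤ y := by
    rintro _ ⟨g, hg, rfl⟩
    exact h g hg
  have hbdd : BddBelow S := ⟨u, hlow⟩
  have hxS : x ∈ S := ⟨1, one_mem _, one_smul _ _⟩
  obtain ⟨i, hi, h1, h2⟩ := exists_mem_Ioo_chainGen hn (hu.trans_le (le_csInf ⟨x, hxS⟩ hlow))
    ((csInf_le hbdd hxS).trans_lt hx')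
  obtain ⟨_, ⟨g, hg, rfl⟩, h4⟩ := exists_lt_of_csInf_lt ⟨x, hxS⟩ (lt_chainGen_smul h1 h2)
  rw [← lt_smul_of_inv_smul_lt] at h4
  refine h4.not_ge (csInf_le hbdd ⟨(chainGen e i)⁻¹ * g, ?_, mul_smul _ _ _⟩)
  exact mul_mem (inv_mem (chainGen_mem e hi)) hg

theorem exists_lt_smul_of_bumpChainGroup {n : ℕ} (hn : n ≠ 0) {e x u : ℝ} (hx : -e < x)
    (hu : u < e * (n - 1) + 2) : ∃ g ∈ bumpChainGroup n e, u < g • x := by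
  by_contra! h
  set S := (fun g : HomeoPlus => g • x) '' (bumpChainGroup n e : Set HomeoPlus)
  have hup : ∀ y ∈ S, y ≤ u := by
    rintro _ ⟨g, hg, rfl⟩
    exact h g hg
  have hbdd : BddAbove S := ⟨u, hup⟩
  have hxS : x ∈ S := ⟨1, one_mem _, one_smul _ _⟩
  obtain ⟨i, hi, h1, h2⟩ := exists_mem_Ioo_chainGen hn (hx.trans_le (le_csSup hbdd hxS))
    ((csSup_le ⟨x, hxS⟩ hup).trans_lt hu)
  have h3 : (chainGen e i)⁻¹ • sSup S < sSup S := by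
    rw [lt_smul_of_inv_smul_lt]
    exact lt_chainGen_smul h1 h2
  obtain ⟨_, ⟨g, hg, rfl⟩, h4⟩ := exists_lt_of_lt_csSup ⟨x, hxS⟩ h3
  rw [lt_smul_of_inv_smul_lt] at h4
  refine h4.not_ge (le_csSup hbdd ⟨chainGen e i * g, ?_, mul_smul _ _ _⟩)
  exact mul_mem (chainGen_mem e hi) hg

/-- Dyadic points of `(0, 2]` are images of `2` under words in two maps, depending only on the
restrictions of these maps to `[0, 2]`. -/
theorem exists_freeGroup_smul_eq_dyadic (m : ℕ) : ∀ j : ℕ, 0 < j → j ≤ 2 ^ (m + 1) →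
    ∃ w : FreeGroup (Fin 2), ∀ A B : HomeoPlus,
      (∀ x : ℝ, 0 ≤ x → x ≤ 2 → A • x = x / 2 + 1) →
      (∀ x : ℝ, 0 ≤ x → x ≤ 1 → B • x = 2 * x) →
      FreeGroup.lift ![A, B] w • (2 : ℝ) = j / 2 ^ m := by
  induction m with
  | zero =>
    intro j hj hj'
    obtain rfl | rfl : j = 1 ∨ j = 2 := by omega
    · refine ⟨(FreeGroup.of 1)⁻¹, fun A B _ hB => ?_⟩
      rw [map_inv, FreeGroup.lift_apply_of, inv_smul_eq_iff]
      change _ = B • _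
      rw [hB _ (by norm_num) (by norm_num)]
      norm_num
    · exact ⟨1, fun A B _ _ => by simp⟩
  | succ m ih =>
    intro j hj hj'
    have hpow : (0 : ℝ) < 2 ^ m := by positivity
    -- B⁻¹ maps (0, 2] onto (0, 1] and A maps it onto (1, 2]; both halve distances.
    rcases le_or_gt j (2 ^ (m + 1)) with h | h
    · obtain ⟨w, hw⟩ := ih j hj h
      refine ⟨(FreeGroup.of 1)⁻¹ * w, fun A B hA hB => ?_⟩
      have h1 : (j : ℝ) ≤ 2 ^ (m + 1) := by exact_mod_cast h
      rw [map_mul, mul_smul, hw A B hA hB, map_inv, FreeGroup.lift_apply_of, inv_smul_eq_iff]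
      change _ = B • _
      rw [hB _ (by positivity) (by rwa [div_le_one (by positivity)]), pow_succ]
      field_simp
    · obtain ⟨w, hw⟩ := ih (j - 2 ^ (m + 1)) (by omega) (by rw [pow_succ] at hj'; omega)
      refine ⟨FreeGroup.of 0 * w, fun A B hA hB => ?_⟩
      have h1 : (j : ℝ) ≤ 2 ^ (m + 1 + 1) := by exact_mod_cast hj'
      have h2 : ((j - 2 ^ (m + 1) : ℕ) : ℝ) = j - 2 ^ (m + 1) := by
        rw [Nat.cast_sub h.le]
        push_cast
        rfl
      have h3 : (2 : ℝ) ^ (m + 1) ≤ j := by exact_mod_cast h.le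
      rw [map_mul, mul_smul, hw A B hA hB, FreeGroup.lift_apply_of, h2]
      change A • _ = _
      rw [hA _ (div_nonneg (by linarith) hpow.le)]
      · rw [pow_succ]
        field_simp
        ring
      · rw [div_le_iff₀ hpow]
        rw [pow_succ, pow_succ] at h1
        rw [pow_succ]
        linarith

theorem exists_freeGroup_smul_mem_Ioo {u v : ℝ} (hu : 0 ≤ u) (huv : u < v) (hv : v ≤ 2) :
    ∃ w : FreeGroup (Fin 2), ∃ q, u < q ∧ q < v ∧ ∀ A B : HomeoPlus,
      (∀ x : ℝ, 0 ≤ x → x ≤ 2 → A • x = x / 2 + 1) →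
      (∀ x : ℝ, 0 ≤ x → x ≤ 1 → B • x = 2 * x) →
      FreeGroup.lift ![A, B] w • (2 : ℝ) = q := by
  obtain ⟨m, hm⟩ := exists_pow_lt_of_lt_one (sub_pos.mpr huv) (one_half_lt_one (α := ℝ))
  have hpow : (0 : ℝ) < 2 ^ m := by positivity
  have h1 : (1 : ℝ) < (v - u) * 2 ^ m := by
    rwa [one_div, inv_pow, inv_lt_iff_one_lt_mul₀ hpow] at hm
  have h2 := Nat.lt_floor_add_one (u * 2 ^ m)
  have h3 := Nat.floor_le (show 0 ≤ u * 2 ^ m by positivity)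
  set j := ⌊u * 2 ^ m⌋₊ + 1 with hj
  have hjc : (j : ℝ) = (⌊u * 2 ^ m⌋₊ : ℝ) + 1 := by
    rw [hj]
    push_cast
    rfl
  have hjv : (j : ℝ) < v * 2 ^ m := by
    rw [hjc]
    linarith
  have hj2 : j ≤ 2 ^ (m + 1) := by
    have : (j : ℝ) ≤ 2 ^ (m + 1) := by
      rw [pow_succ]
      nlinarith
    exact_mod_cast this
  obtain ⟨w, hw⟩ := exists_freeGroup_smul_eq_dyadic m j (Nat.succ_pos _) hj2
  refine ⟨w, j / 2 ^ m, ?_, ?_, hw⟩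
  · rw [lt_div_iff₀ hpow, hjc]
    exact h2
  · rwa [div_lt_iff₀ hpow]

/-- The orbit of 2 is dense: a group element brings a point of (u, v) below 2, powers of `chainGen e
0`, which fix 2, lift it above 0, and in (0, 2) the dyadic points are available. -/
theorem exists_smul_two_mem_Ioo {n : ℕ} (hn : 2 ≤ n) {e u v : ℝ} (he : 2 ≤ e) (huv : u < v)
    (hv : -e < v) (hu : u < e * (n - 1) + 2) :
    ∃ g ∈ bumpChainGroup n e, u < g • (2 : ℝ) ∧ g • (2 : ℝ) < v := by
  have hn' : (1 : ℝ) ≤ n - 1 := by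
    have : (2 : ℝ) ≤ n := by exact_mod_cast hn
    linarith
  obtain ⟨x, hx, hx'⟩ : ∃ x, max u (-e) < x ∧ x < min v (e * (n - 1) + 2) :=
    exists_between (max_lt (lt_min huv hu) (lt_min hv (by nlinarith)))
  rw [max_lt_iff] at hx
  rw [lt_min_iff] at hx'
  obtain ⟨g₁, hg₁, h₁⟩ := exists_smul_lt_of_bumpChainGroup (by omega : n ≠ 0)
    (show -e < 2 by linarith) hx'.2
  have h₀ := (mem_Ioo_smul_of_mem_bumpChainGroup he hg₁ hx.2 hx'.2).1
  obtain ⟨k, hk⟩ := exists_lt_pow_smul (g := chainGen e 0) (a := 0) (x := g₁ • x)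
    fun y hy hy' => lt_chainGen_smul (by push_cast; linarith) (by push_cast; linarith)
  set g := chainGen e 0 ^ k * g₁ with hg
  have hgG : g ∈ bumpChainGroup n e := mul_mem (pow_mem (chainGen_mem e (by omega)) k) hg₁
  have hgx : 0 < g • x := by rwa [hg, mul_smul]
  have hgx' : g • x < 2 := by
    have h2 : chainGen e 0 ^ k • (2 : ℝ) = 2 := by
      have : chainGen e 0 ∈ MulAction.stabilizer HomeoPlus (2 : ℝ) :=
        chainGen_smul_of_ge (by push_cast; linarith)
      exact pow_mem this k
    rw [hg, mul_smul, ← h2, smul_lt_smul]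
    exact h₁
  obtain ⟨w, q, hq, hq', hw⟩ := exists_freeGroup_smul_mem_Ioo (le_max_right (g • u) 0)
    (max_lt (lt_min ((smul_lt_smul g).mpr huv) (((smul_lt_smul g).mpr hx.1).trans hgx'))
      (lt_min (hgx.trans ((smul_lt_smul g).mpr hx'.1)) two_pos)) (min_le_right (g • v) 2)
  specialize hw (chainGen e 0) (chainGen e 1) (fun _ => chainGen_zero_smul he) fun y hy hy' => by
    rw [chainGen_one_smul hy (by linarith)]
    grind
  have hwG : FreeGroup.lift ![chainGen e 0, chainGen e 1] w ∈ bumpChainGroup n e := by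
    have hr : Set.range ![chainGen e 0, chainGen e 1] ⊆ bumpChainGroup n e := by
      rintro _ ⟨i, rfl⟩
      fin_cases i
      · exact chainGen_mem e (by omega)
      · exact chainGen_mem e (by omega)
    exact FreeGroup.range_lift_le hr ⟨w, rfl⟩
  refine ⟨g⁻¹ * FreeGroup.lift ![chainGen e 0, chainGen e 1] w, mul_mem (inv_mem hgG) hwG, ?_, ?_⟩
  · rw [mul_smul, hw, smul_lt_of_lt_inv_smul]
    exact (le_max_left _ _).trans_lt hq
  · rw [mul_smul, hw, lt_smul_of_inv_smul_lt]
    exact hq'.trans_le (min_le_left _ _)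

/-- With h 2 in (u, v), it suffices to push [s, t] below 2 and then, by powers of `chainGen e 0`,
which fix 2, above h⁻¹ u. -/
theorem exists_compress_of_bumpChainGroup {n : ℕ} (hn : 2 ≤ n) {e s t u v : ℝ} (he : 2 ≤ e)
    (hs : -e < s) (hst : s ≤ t) (ht : t < e * (n - 1) + 2) (hu : -e < u) (huv : u < v)
    (hv : v < e * (n - 1) + 2) : ∃ g ∈ bumpChainGroup n e, u < g • s ∧ g • t < v := by
  obtain ⟨h, hhG, hhu, hhv⟩ := exists_smul_two_mem_Ioo hn he huv (hu.trans huv) (huv.trans hv)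
  obtain ⟨g, hgG, hgt⟩ := exists_smul_lt_of_bumpChainGroup (by omega : n ≠ 0)
    (show -e < 2 by linarith) ht
  have hgs := (mem_Ioo_smul_of_mem_bumpChainGroup he hgG hs (hst.trans_lt ht)).1
  obtain ⟨k, hk⟩ := exists_lt_pow_smul (g := chainGen e 0) (a := h⁻¹ • u) (x := g • s)
    fun y hy hy' => lt_chainGen_smul (by push_cast; linarith)
      (by push_cast; rw [← smul_lt_smul h⁻¹, inv_smul_smul] at hhu; linarith)
  have h2 : chainGen e 0 ^ k • (2 : ℝ) = 2 := by
    have : chainGen e 0 ∈ MulAction.stabilizer HomeoPlus (2 : ℝ) :=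
      chainGen_smul_of_ge (by push_cast; linarith)
    exact pow_mem this k
  refine ⟨h * (chainGen e 0 ^ k * g), mul_mem hhG (mul_mem (pow_mem
    (chainGen_mem e (by omega)) k) hgG), ?_, ?_⟩
  · rw [mul_smul, mul_smul, ← lt_smul_of_inv_smul_lt]
    exact hk
  · refine lt_trans ?_ hhv
    rw [mul_smul, mul_smul, smul_lt_smul, ← h2, smul_lt_smul]
    exact hgt

/-! ### The commutator subgroup: compression, compact supports, simplicity. -/

theorem abelianization_of_conj {G : Type*} [Group G] (p x : G) :
    Abelianization.of (p * x * p⁻¹) = Abelianization.of x := by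
  rw [map_mul, map_mul, map_inv, mul_right_comm, mul_inv_cancel, one_mul]

theorem abelianization_of_mul {G : Type*} [Group G] {x y x' y' : G}
    (hx : Abelianization.of x = Abelianization.of x')
    (hy : Abelianization.of y = Abelianization.of y') :
    Abelianization.of (x * y) = Abelianization.of (x' * y') := by
  rw [map_mul, map_mul, hx, hy]

theorem abelianization_of_inv {G : Type*} [Group G] {x x' : G}
    (hx : Abelianization.of x = Abelianization.of x') :
    Abelianization.of x⁻¹ = Abelianization.of x'⁻¹ := by
  rw [map_inv, map_inv, hx]

/-- Modulo commutators, every element of the group can be made trivial on a given compact set. -/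
theorem exists_trivial_representative {n : ℕ} (hn : 2 ≤ n) {e s t : ℝ} (he : 2 ≤ e) (hs : -e < s)
    (ht : t < e * (n - 1) + 2) (g : bumpChainGroup n e) :
    ∃ z : bumpChainGroup n e, (∀ x : ℝ, s ≤ x → x ≤ t → z • x = x) ∧
      Abelianization.of z = Abelianization.of g := by
  have hg : g ∈ Subgroup.closure
      (((↑) : bumpChainGroup n e → HomeoPlus) ⁻¹' Set.range fun i : Fin n => chainGen e i) := by
    have h := Subgroup.closure_closure_coe_preimage (k := Set.range fun i : Fin n => chainGen e i)
    exact (SetLike.ext_iff.mp h g).mpr trivial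
  induction hg using Subgroup.closure_induction with
  | mem f hf =>
    obtain ⟨i, hi⟩ := hf
    have hin := i.2
    have hi' : ((i : ℕ) : ℝ) + 1 ≤ n := by exact_mod_cast hin
    have hfi : ∀ x : ℝ, f • x = chainGen e i • x := fun x => congrArg (· • x) hi.symm
    -- Conjugation preserves the class. The support of any generator but the last stays away from
    -- the right end, so it can be moved left of s; that of the last can be moved right of t.
    rcases lt_or_ge ((i : ℕ) + 1) n with hin | hin
    · have hi' : ((i : ℕ) : ℝ) + 2 ≤ n := by exact_mod_cast hin
      obtain ⟨p, hp, hpx⟩ := exists_smul_lt_of_bumpChainGroup (by omega : n ≠ 0) hs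
        (show e * i + 2 < e * (n - 1) + 2 by nlinarith)
      obtain ⟨P, rfl⟩ : ∃ P : bumpChainGroup n e, P.1 = p := ⟨⟨p, hp⟩, rfl⟩
      refine ⟨P * f * P⁻¹, fun x hx _ => ?_, abelianization_of_conj P f⟩
      rw [mul_smul, mul_smul, smul_eq_iff_eq_inv_smul, hfi]
      refine chainGen_smul_of_ge ?_
      change _ ≤ P.1⁻¹ • x
      rw [← smul_le_smul P.1, smul_inv_smul]
      linarith
    · have hi' : (1 : ℝ) ≤ (i : ℕ) := by
        have : 1 ≤ (i : ℕ) := by omega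
        exact_mod_cast this
      obtain ⟨p, hp, hpx⟩ := exists_lt_smul_of_bumpChainGroup (by omega : n ≠ 0)
        (show -e < e * (i - 1) by nlinarith) ht
      obtain ⟨P, rfl⟩ : ∃ P : bumpChainGroup n e, P.1 = p := ⟨⟨p, hp⟩, rfl⟩
      refine ⟨P * f * P⁻¹, fun x _ hx => ?_, abelianization_of_conj P f⟩
      rw [mul_smul, mul_smul, smul_eq_iff_eq_inv_smul, hfi]
      refine chainGen_smul_of_le ?_
      change P.1⁻¹ • x ≤ _
      rw [← smul_le_smul P.1, smul_inv_smul]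
      linarith
  | one => exact ⟨1, fun x _ _ => one_smul _ x, rfl⟩
  | mul a b ha hb iha ihb =>
    obtain ⟨z, hz, hz'⟩ := iha
    obtain ⟨w, hw, hw'⟩ := ihb
    refine ⟨z * w, fun x hx hx' => ?_, abelianization_of_mul hz' hw'⟩
    rw [mul_smul, hw x hx hx', hz x hx hx']
  | inv a ha iha =>
    obtain ⟨z, hz, hz'⟩ := iha
    exact ⟨z⁻¹, fun x hx hx' => inv_smul_eq_self.mpr (hz x hx hx'), abelianization_of_inv hz'⟩

/-- Divide a compressing element of the whole group by an element of the same class that is trivial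
on [s, t]. -/
theorem exists_compress_of_commutator {n : ℕ} (hn : 2 ≤ n) {e s t u v : ℝ} (he : 2 ≤ e)
    (hs : -e < s) (hst : s ≤ t) (ht : t < e * (n - 1) + 2) (hu : -e < u) (huv : u < v)
    (hv : v < e * (n - 1) + 2) :
    ∃ g : commutator (bumpChainGroup n e), u < g • s ∧ g • t < v := by
  obtain ⟨g, hg, h1, h2⟩ := exists_compress_of_bumpChainGroup hn he hs hst ht hu huv hv
  obtain ⟨z, hz, hz'⟩ := exists_trivial_representative hn he hs ht ⟨g, hg⟩
  have hmem : (⟨g, hg⟩ : bumpChainGroup n e) * z⁻¹ ∈ commutator (bumpChainGroup n e) := by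
    rw [← Abelianization.ker_of, MonoidHom.mem_ker, map_mul, map_inv, hz', mul_inv_cancel]
  have hfix : ∀ x : ℝ, s ≤ x → x ≤ t → (⟨_, hmem⟩ : commutator (bumpChainGroup n e)) • x =
      g • x := by
    intro x hx hx'
    change ((⟨g, hg⟩ : bumpChainGroup n e) * z⁻¹) • x = g • x
    rw [mul_smul, inv_smul_eq_self.mpr (hz x hx hx')]
    rfl
  refine ⟨⟨_, hmem⟩, ?_, ?_⟩
  · rwa [hfix s le_rfl hst]
  · rwa [hfix t hst le_rfl]

/-- Near the point `p` of `S`, the map `g` is affine with fixed point `p` and slope `2 ^ k`. -/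
def HasGerm (p : ℝ) (S : Set ℝ) (g : HomeoPlus) (k : ℤ) : Prop :=
  ∀ᶠ x in 𝓝[S] p, g • x = p + 2 ^ k * (x - p)

theorem tendsto_affine_nhdsWithin {p : ℝ} {S : Set ℝ}
    (hS : ∀ c : ℝ, 0 < c → ∀ x ∈ S, p + c * (x - p) ∈ S) (k : ℤ) :
    Filter.Tendsto (fun x => p + 2 ^ k * (x - p)) (𝓝[S] p) (𝓝[S] p) := by
  refine tendsto_nhdsWithin_iff.mpr ⟨?_, ?_⟩
  · have : Continuous fun x : ℝ => p + 2 ^ k * (x - p) := by fun_prop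
    have h := this.tendsto p
    simp only [sub_self, mul_zero, add_zero] at h
    exact h.mono_left nhdsWithin_le_nhds
  · filter_upwards [self_mem_nhdsWithin] with x hx
    exact hS _ (by positivity) x hx

theorem HasGerm.mul {p : ℝ} {S : Set ℝ} (hS : ∀ c : ℝ, 0 < c → ∀ x ∈ S, p + c * (x - p) ∈ S)
    {g h : HomeoPlus} {k l : ℤ} (hg : HasGerm p S g k) (hh : HasGerm p S h l) :
    HasGerm p S (g * h) (k + l) := by
  filter_upwards [hh, (tendsto_affine_nhdsWithin hS l).eventually hg] with x hx hx'
  rw [mul_smul, hx, hx', zpow_add₀ two_ne_zero]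
  ring

theorem HasGerm.inv {p : ℝ} {S : Set ℝ} (hS : ∀ c : ℝ, 0 < c → ∀ x ∈ S, p + c * (x - p) ∈ S)
    {g : HomeoPlus} {k : ℤ} (hg : HasGerm p S g k) : HasGerm p S g⁻¹ (-k) := by
  filter_upwards [(tendsto_affine_nhdsWithin hS (-k)).eventually hg] with x hx
  rw [inv_smul_eq_iff, hx, add_sub_cancel_left, ← mul_assoc, ← zpow_add₀ two_ne_zero,
    add_neg_cancel, zpow_zero]
  ring

/-- The exponent of the slope at p is additive under composition, so it vanishes on commutators. -/
theorem hasGerm_zero_of_mem_commutator {p : ℝ} {S : Set ℝ}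
    (hS : ∀ c : ℝ, 0 < c → ∀ x ∈ S, p + c * (x - p) ∈ S) {T : Set HomeoPlus}
    (hT : ∀ f ∈ T, ∃ k, HasGerm p S f k) (g : commutator (Subgroup.closure T)) :
    HasGerm p S g 0 := by
  have hone : HasGerm p S 1 0 := Filter.Eventually.of_forall fun x => by simp
  have hgerm : ∀ f ∈ Subgroup.closure T, ∃ k, HasGerm p S f k := by
    intro f hf
    induction hf using Subgroup.closure_induction with
    | mem f hf => exact hT f hf
    | one => exact ⟨0, hone⟩
    | mul a b _ _ iha ihb =>
      obtain ⟨k, hk⟩ := iha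
      obtain ⟨l, hl⟩ := ihb
      exact ⟨k + l, hk.mul hS hl⟩
    | inv a _ iha =>
      obtain ⟨k, hk⟩ := iha
      exact ⟨-k, hk.inv hS⟩
  set Z : Subgroup HomeoPlus :=
    { carrier := {f | HasGerm p S f 0}
      one_mem' := hone
      mul_mem' := fun ha hb => by simpa using HasGerm.mul hS ha hb
      inv_mem' := fun ha => by simpa using HasGerm.inv hS ha }
  have hle : commutator (Subgroup.closure T) ≤ Z.comap (Subgroup.closure T).subtype := by
    rw [commutator_def, Subgroup.commutator_le]
    intro a _ b _
    obtain ⟨k, hk⟩ := hgerm a a.2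
    obtain ⟨l, hl⟩ := hgerm b b.2
    have := ((hk.mul hS hl).mul hS (hk.inv hS)).mul hS (hl.inv hS)
    rw [show k + l + -k + -l = 0 by ring] at this
    exact this
  exact hle g.2

/-- At both ends of the interval the generators have affine germs with slope a power of 2, so
elements of the commutator subgroup are the identity near the ends. -/
theorem exists_compact_support_of_commutator {n : ℕ} (hn : 2 ≤ n) {e : ℝ} (he : 2 ≤ e)
    (g : commutator (bumpChainGroup n e)) :
    ∃ s t, -e < s ∧ s ≤ t ∧ t < e * (n - 1) + 2 ∧ ∀ x : ℝ, x < s ∨ t < x → g • x = x := by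
  have hn' : (2 : ℝ) ≤ n := by exact_mod_cast hn
  have hL : 0 < e * (n - 1) + 2 := by nlinarith
  have h1 : HasGerm (-e) (Set.Ioi (-e)) g 0 := by
    refine hasGerm_zero_of_mem_commutator ?_ ?_ g
    · intro c hc x hx
      rw [Set.mem_Ioi] at hx ⊢
      nlinarith
    · rintro _ ⟨i, rfl⟩
      rcases Nat.eq_zero_or_pos i with hi | hi
      · refine ⟨1, ?_⟩
        filter_upwards [Ioo_mem_nhdsGT (show -e < -e + 1 by linarith)] with x hx
        obtain ⟨hx, hx'⟩ := hx
        rw [hi, chainGen, bump_smul, zpow_one]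
        push_cast
        grind
      · refine ⟨0, ?_⟩
        have hi' : (1 : ℝ) ≤ (i : ℕ) := by exact_mod_cast hi
        filter_upwards [Ioo_mem_nhdsGT (show -e < 0 by linarith)] with x hx
        rw [chainGen_smul_of_le (by nlinarith [hx.2]), zpow_zero]
        ring
  have h2 : HasGerm (e * (n - 1) + 2) (Set.Iio (e * (n - 1) + 2)) g 0 := by
    refine hasGerm_zero_of_mem_commutator ?_ ?_ g
    · intro c hc x hx
      rw [Set.mem_Iio] at hx ⊢
      nlinarith
    · rintro _ ⟨i, rfl⟩
      rcases lt_or_ge ((i : ℕ) + 1) n with hin | hin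
      · refine ⟨0, ?_⟩
        have hi' : ((i : ℕ) : ℝ) + 2 ≤ n := by exact_mod_cast hin
        filter_upwards [Ioo_mem_nhdsLT
          (show e * (n - 1) < e * (n - 1) + 2 by linarith)] with x hx
        rw [chainGen_smul_of_ge (by nlinarith [hx.1]), zpow_zero]
        ring
      · refine ⟨-1, ?_⟩
        have hi' : ((i : ℕ) : ℝ) = n - 1 := by
          rw [eq_sub_iff_add_eq]
          have : (i : ℕ) + 1 = n := le_antisymm i.2 hin
          exact_mod_cast this
        filter_upwards [Ioo_mem_nhdsLT
          (show e * (n - 1) + 1 < e * (n - 1) + 2 by linarith)] with x hx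
        obtain ⟨hx, hx'⟩ := hx
        rw [chainGen, bump_smul, zpow_neg_one, hi']
        grind
  obtain ⟨s, hs, hsx⟩ := (mem_nhdsGT_iff_exists_Ioo_subset).mp h1
  obtain ⟨t, ht, htx⟩ := (mem_nhdsLT_iff_exists_Ioo_subset).mp h2
  rw [Set.mem_Ioi] at hs
  rw [Set.mem_Iio] at ht
  -- Including the interior point 0 guarantees that the two bounds are in order.
  refine ⟨min s 0, max t 0, lt_min hs (by linarith), (min_le_right _ _).trans (le_max_right _ _),
    max_lt ht hL, fun x hx => ?_⟩
  have hout : ∀ x : ℝ, x ≤ -e ∨ e * (n - 1) + 2 ≤ x → g • x = x :=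
    fun x hx => smul_eq_of_mem_bumpChainGroup he g.1.2 hx
  rcases hx with hx | hx
  · rcases le_or_gt x (-e) with hxe | hxe
    · exact hout x (Or.inl hxe)
    · have h3 : g • x = -e + 2 ^ (0 : ℤ) * (x - -e) :=
        hsx ⟨hxe, hx.trans_le (min_le_left _ _)⟩
      rw [h3, zpow_zero]
      ring
  · rcases le_or_gt (e * (n - 1) + 2) x with hxe | hxe
    · exact hout x (Or.inr hxe)
    · have h3 : g • x = (e * (n - 1) + 2) + 2 ^ (0 : ℤ) * (x - (e * (n - 1) + 2)) :=
        htx ⟨(le_max_left _ _).trans_lt hx, hxe⟩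
      rw [h3, zpow_zero]
      ring

theorem commute_conj_of_fixes {f h : HomeoPlus} {b c : ℝ} (hf : ∀ x : ℝ, c ≤ x → f • x = x)
    (hh : ∀ x : ℝ, x ≤ b → h • x = x) (p : HomeoPlus) (hp : c ≤ p • b) :
    Commute f (p * h * p⁻¹) := by
  refine commute_of_forall_smul_eq (X := ℝ) fun x => ?_
  rcases le_total c x with hx | hx
  · exact Or.inl (hf x hx)
  · right
    rw [mul_smul, mul_smul, smul_eq_iff_eq_inv_smul]
    refine hh _ ?_
    rw [← smul_le_smul p, smul_inv_smul]
    exact hx.trans hp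

theorem commute_chainGen_of_add_one_lt {e : ℝ} (he : 2 ≤ e) {i k : ℕ} (hik : i + 1 < k) :
    Commute (chainGen e i) (chainGen e k) := by
  refine commute_of_forall_smul_eq (X := ℝ) fun x => ?_
  have h : (i : ℝ) + 2 ≤ k := by exact_mod_cast hik
  rcases le_total (e * i + 2) x with hx | hx
  · exact Or.inl (chainGen_smul_of_ge hx)
  · exact Or.inr (chainGen_smul_of_le (by nlinarith))

/-- X carries the left end ei of the support of `chainGen e (i + 1)` to the right end ei + 2 of that
of `chainGen e i`, so conjugating by X or X² makes the supports disjoint. -/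
theorem chainGen_relations {e : ℝ} (he : 2 ≤ e) (i : ℕ) :
    ∀ X, X = chainGen e (i + 1) * chainGen e i →
    Commute (chainGen e i) (X * chainGen e (i + 1) * X⁻¹) ∧
    Commute (chainGen e i) (X * (X * chainGen e (i + 1) * X⁻¹) * X⁻¹) := by
  rintro X rfl
  have hb : ∀ x : ℝ, x ≤ e * i → chainGen e (i + 1) • x = x := fun x hx =>
    chainGen_smul_of_le (by push_cast; linarith)
  have hc : ∀ x : ℝ, e * i + 2 ≤ x → chainGen e i • x = x := fun x hx => chainGen_smul_of_ge hx
  have h1 : (chainGen e (i + 1) * chainGen e i) • (e * i) = e * i + 2 := by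
    have h2 : chainGen e i • (e * i) = e * i + 1 := by
      rw [chainGen, bump_smul]
      grind
    rw [mul_smul, h2, chainGen, bump_smul]
    push_cast
    grind
  refine ⟨commute_conj_of_fixes hc hb _ h1.ge, ?_⟩
  have h3 := commute_conj_of_fixes hc hb
    ((chainGen e (i + 1) * chainGen e i) * (chainGen e (i + 1) * chainGen e i)) (by
      rw [mul_smul, h1, mul_smul, hc _ le_rfl]
      exact le_bump_smul _ _ _)
  simpa only [mul_inv_rev, mul_assoc] using h3

theorem commutator_commutator_bumpChainGroup (n : ℕ) {e : ℝ} (he : 2 ≤ e) :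
    commutator (commutator (bumpChainGroup n e)) = ⊤ := by
  refine commutator_commutator_eq_top_of_generators
    (((↑) : bumpChainGroup n e → HomeoPlus) ⁻¹' Set.range fun i : Fin n => chainGen e i)
    Subgroup.closure_closure_coe_preimage ?_
  have key : ∀ (Q : Type) [Group Q], (∀ a b c d : Q, Commute ⁅a, b⁆ ⁅c, d⁆) →
      ∀ φ : bumpChainGroup n e →* Q, ∀ (i k : ℕ) (hi : i < n) (hk : k < n), i ≤ k →
      Commute (φ ⟨_, chainGen_mem e hi⟩) (φ ⟨_, chainGen_mem e hk⟩) := by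
    intro Q _ hQ φ i k hi hk hik
    rcases hik.eq_or_lt with rfl | hik
    · exact Commute.refl _
    rcases (Nat.succ_le_of_lt hik).eq_or_lt with rfl | hik
    · obtain ⟨h1, h2⟩ := chainGen_relations he i _ rfl
      refine commute_of_thompson_relations hQ ?_ ?_
      · rw [← map_mul, ← map_inv, ← map_mul, ← map_mul]
        exact Commute.map (Subtype.ext h1.eq) φ
      · rw [← map_mul, ← map_inv, ← map_mul, ← map_mul, ← map_mul, ← map_mul]
        exact Commute.map (Subtype.ext h2.eq) φ
    · exact Commute.map (Subtype.ext (commute_chainGen_of_add_one_lt he hik).eq) φ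
  rintro Q _ hQ φ ⟨_, hx⟩ ⟨i, rfl⟩ ⟨_, hy⟩ ⟨k, rfl⟩
  rcases le_total (i : ℕ) k with h | h
  · exact key Q hQ φ i k i.2 k.2 h
  · exact (key Q hQ φ k i k.2 i.2 h).symm

theorem isSimpleGroup_commutator_bumpChainGroup {n : ℕ} (hn : 2 ≤ n) {e : ℝ} (he : 2 ≤ e) :
    IsSimpleGroup (commutator (bumpChainGroup n e)) := by
  have hnt : Nontrivial (commutator (bumpChainGroup n e)) := by
    rw [Subgroup.nontrivial_iff_exists_ne_one]
    set f₀ : bumpChainGroup n e := ⟨_, chainGen_mem e (by omega : 0 < n)⟩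
    set f₁ : bumpChainGroup n e := ⟨_, chainGen_mem e (by omega : 1 < n)⟩
    refine ⟨⁅f₀, f₁⁆, Subgroup.commutator_mem_commutator trivial trivial, fun h => ?_⟩
    rw [commutatorElement_eq_one_iff_mul_comm] at h
    have h1 : (f₀ * f₁) • (1 : ℝ) = (f₁ * f₀) • (1 : ℝ) := by rw [h]
    change chainGen e 0 • chainGen e 1 • (1 : ℝ) = chainGen e 1 • chainGen e 0 • (1 : ℝ) at h1
    rw [chainGen_zero_smul he zero_le_one one_le_two,
      chainGen_one_smul zero_le_one (by linarith),
      chainGen_one_smul (by norm_num) (by linarith),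
      chainGen_zero_smul he (by norm_num) (by norm_num)] at h1
    norm_num at h1
  exact isSimpleGroup_of_compressible (fun g => smul_strictMono g.1.1) (-e) (e * (n - 1) + 2)
    (exists_compact_support_of_commutator hn he)
    (fun s t u v hs hst ht hu huv hv => exists_compress_of_commutator hn he hs hst ht hu huv hv)
    (commutator_commutator_bumpChainGroup n he)

/-! ### Encoding e in the commutator subgroup. -/

theorem commutatorElement_smul_of_fixes {Γ X : Type*} [Group Γ] [MulAction Γ X] {g h : Γ} {x : X}
    (hx : g • h⁻¹ • x = h⁻¹ • x) : ⁅g, h⁆ • x = g • x := by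
  rw [commutatorElement_def, mul_assoc, mul_assoc, mul_smul]
  congr 1
  rw [mul_smul, mul_smul, smul_eq_iff_eq_inv_smul, inv_smul_eq_self]
  exact hx

/-- Elements of the commutator subgroup which agree with the generators on suitable intervals. -/
theorem exists_commutator_eq_chainGen {n : ℕ} (hn : 3 ≤ n) {e : ℝ} (he : 2 < e) (he' : e < 3) :
    ∃ A B C : commutator (bumpChainGroup n e),
      (∀ x : ℝ, 0 ≤ x → x ≤ 2 → A • x = x / 2 + 1) ∧ (∀ x : ℝ, 2 ≤ x → A • x = x) ∧
      (∀ x : ℝ, 0 ≤ x → x ≤ 2 → B • x = min (2 * x) (x + 1)) ∧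
      (∀ x : ℝ, x ≤ e → C • x = x) ∧ (∀ x : ℝ, e < x → x ≤ 3 → x < C • x) := by
  set f₀ : bumpChainGroup n e := ⟨_, chainGen_mem e (by omega : 0 < n)⟩
  set f₁ : bumpChainGroup n e := ⟨_, chainGen_mem e (by omega : 1 < n)⟩
  set f₂ : bumpChainGroup n e := ⟨_, chainGen_mem e (by omega : 2 < n)⟩
  have hlt : ∀ (g : bumpChainGroup n e) {x y : ℝ}, g • x ≤ g • y ↔ x ≤ y :=
    fun g => smul_le_smul g.1
  have h₀ : ∀ x : ℝ, 0 ≤ x → x ≤ 2 → f₀ • x = x / 2 + 1 := fun x => chainGen_zero_smul he.le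
  have h₀' : ∀ x : ℝ, 2 ≤ x → f₀ • x = x := fun x hx =>
    chainGen_smul_of_ge (by push_cast; linarith)
  have h₁ : ∀ x : ℝ, 0 ≤ x → x ≤ e → f₁ • x = min (2 * x) (x + 1) := fun x => chainGen_one_smul
  have h₁' : ∀ x : ℝ, x ≤ 0 → f₁ • x = x := fun x hx =>
    chainGen_smul_of_le (by push_cast; linarith)
  have h₂ : ∀ x : ℝ, x ≤ e → f₂ • x = x := fun x hx =>
    chainGen_smul_of_le (by push_cast; linarith)
  have h₂' : ∀ x : ℝ, e < x → x ≤ 3 → x < f₂ • x := fun x hx hx' =>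
    lt_chainGen_smul (by push_cast; linarith) (by push_cast; linarith)
  -- ⁅g, h⁆ agrees with g wherever h⁻¹ leads to fixed points of g. Here h 2 = -1/2, so h⁻¹ takes [0,
  -- ∞) beyond 2, where f₀ is trivial.
  have hA : ∀ x : ℝ, 0 ≤ x → ⁅f₀, f₀⁻¹ * (f₁⁻¹ * f₁⁻¹)⁆ • x = f₀ • x := by
    intro x hx
    refine commutatorElement_smul_of_fixes (h₀' _ ?_)
    have e1 : f₀ • (-(1 / 2) : ℝ) = 1 / 2 := by
      change chainGen e 0 • (-(1 / 2) : ℝ) = 1 / 2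
      rw [chainGen, bump_smul]
      push_cast
      grind
    have e2 : f₁ • (1 / 2 : ℝ) = 1 := by
      rw [h₁ _ (by norm_num) (by linarith)]
      norm_num
    have e3 : f₁ • (1 : ℝ) = 2 := by
      rw [h₁ _ (by norm_num) (by linarith)]
      norm_num
    have e4 : (f₀⁻¹ * (f₁⁻¹ * f₁⁻¹)) • (2 : ℝ) = -(1 / 2) := by
      rw [mul_smul, mul_smul, inv_smul_eq_iff, e1, inv_smul_eq_iff, e2, inv_smul_eq_iff, e3]
    rw [← hlt (f₀⁻¹ * (f₁⁻¹ * f₁⁻¹)), smul_inv_smul, e4]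
    linarith
  -- Here h 0 = 3, so h⁻¹ takes (-∞, 3] into (-∞, 0], where f₁ is trivial.
  have hB : ∀ x : ℝ, x ≤ 3 → ⁅f₁, f₁ * (f₁ * f₀)⁆ • x = f₁ • x := by
    intro x hx
    refine commutatorElement_smul_of_fixes (h₁' _ ?_)
    have e1 : (f₁ * (f₁ * f₀)) • (0 : ℝ) = 3 := by
      have e2 : f₁ • (1 : ℝ) = 2 := by
        rw [h₁ _ (by norm_num) (by linarith)]
        norm_num
      have e3 : f₁ • (2 : ℝ) = 3 := by
        rw [h₁ _ (by norm_num) (by linarith)]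
        norm_num
      rw [mul_smul, mul_smul, h₀ _ le_rfl two_pos.le, zero_div, zero_add, e2, e3]
    rwa [← hlt (f₁ * (f₁ * f₀)), smul_inv_smul, e1]
  -- Here h e = e + 1, which exceeds 3 because e > 2.
  have hC : ∀ x : ℝ, x ≤ e + 1 → ⁅f₂, f₁⁆ • x = f₂ • x := by
    intro x hx
    refine commutatorElement_smul_of_fixes (h₂ _ ?_)
    have e1 : f₁ • e = e + 1 := by
      rw [h₁ _ (by linarith) le_rfl, min_eq_right]
      linarith
    rwa [← hlt f₁, smul_inv_smul, e1]
  refine ⟨⟨_, Subgroup.commutator_mem_commutator (Subgroup.mem_top f₀)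
      (Subgroup.mem_top (f₀⁻¹ * (f₁⁻¹ * f₁⁻¹)))⟩,
    ⟨_, Subgroup.commutator_mem_commutator (Subgroup.mem_top f₁)
      (Subgroup.mem_top (f₁ * (f₁ * f₀)))⟩,
    ⟨_, Subgroup.commutator_mem_commutator (Subgroup.mem_top f₂) (Subgroup.mem_top f₁)⟩,
    fun x hx hx' => ?_, fun x hx => ?_, fun x hx hx' => ?_, fun x hx => ?_, fun x hx hx' => ?_⟩
  · exact (hA x hx).trans (h₀ x hx hx')
  · exact (hA x (by linarith)).trans (h₀' x hx)
  · exact (hB x (by linarith)).trans (h₁ x hx (by linarith))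
  · exact (hC x (by linarith)).trans (h₂ x hx)
  · exact (h₂' x hx hx').trans_eq (hC x (by linarith)).symm

/-- The relation `[w a w⁻¹, b⁻¹ c b] = 1`, for a word `w` in `a` and `b`. -/
def CommRel {G : Type*} [Group G] (a b c : G) (w : FreeGroup (Fin 2)) : Prop :=
  Commute (FreeGroup.lift ![a, b] w * a * (FreeGroup.lift ![a, b] w)⁻¹) (b⁻¹ * c * b)

theorem commRel_map_iff {G H : Type*} [Group G] [Group H] {φ : G →* H}
    (hφ : Function.Injective φ) (a b c : G) (w : FreeGroup (Fin 2)) :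
    CommRel (φ a) (φ b) (φ c) w ↔ CommRel a b c w := by
  have h : FreeGroup.lift ![φ a, φ b] w = φ (FreeGroup.lift ![a, b] w) := by
    have h1 : FreeGroup.lift ![φ a, φ b] = φ.comp (FreeGroup.lift ![a, b]) := by
      ext i
      fin_cases i <;> simp
    rw [h1]
    rfl
  rw [CommRel, CommRel, h]
  simp only [← map_inv, ← map_mul]
  exact ⟨fun h => hφ (by simpa only [map_mul] using h.eq), fun h => h.map φ⟩

/-- The support of w a w⁻¹ ends at q and that of b⁻¹ c b begins at b⁻¹ e. The bounds on e put e - 1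
in (1, 2), where b is translation by 1, so b⁻¹ e = e - 1. -/
theorem commRel_iff {a b c : HomeoPlus} {e q : ℝ} {w : FreeGroup (Fin 2)} (he : 2 < e)
    (he' : e < 3) (ha : ∀ x : ℝ, 0 ≤ x → x ≤ 2 → a • x = x / 2 + 1)
    (ha' : ∀ x : ℝ, 2 ≤ x → a • x = x)
    (hb : ∀ x : ℝ, 0 ≤ x → x ≤ 2 → b • x = min (2 * x) (x + 1))
    (hc : ∀ x : ℝ, x ≤ e → c • x = x) (hc' : ∀ x : ℝ, e < x → x ≤ 3 → x < c • x)
    (hw : FreeGroup.lift ![a, b] w • (2 : ℝ) = q) (hq : q < 2) :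
    CommRel a b c w ↔ q ≤ e - 1 := by
  set W := FreeGroup.lift ![a, b] w
  have hX : ∀ x : ℝ, q ≤ x → (W * a * W⁻¹) • x = x := by
    intro x hx
    rw [mul_smul, mul_smul, smul_eq_iff_eq_inv_smul]
    refine ha' _ ?_
    rwa [← smul_le_smul W, smul_inv_smul, hw]
  constructor
  · intro h
    by_contra! hqe
    have hY : q < (b⁻¹ * c * b) • q := by
      rw [mul_smul, mul_smul, ← smul_lt_smul b, smul_inv_smul, hb q (by linarith) hq.le,
        min_eq_right (by linarith)]
      exact hc' _ (by linarith) (by linarith)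
    have hW0 : W • (0 : ℝ) < q := by
      rw [← hw, smul_lt_smul]
      exact two_pos
    -- A point x just below q is moved by W a W⁻¹, while b⁻¹ c b throws it past q, where W a W⁻¹ is
    -- trivial; commuting maps cannot do this.
    obtain ⟨x, hx, hxq⟩ := exists_between (max_lt (lt_smul_of_inv_smul_lt.mpr hY) hW0)
    rw [max_lt_iff, lt_smul_of_inv_smul_lt] at hx
    have hmove : (W * a * W⁻¹) • x ≠ x := by
      rw [mul_smul, mul_smul, Ne, smul_eq_iff_eq_inv_smul]
      have h0 : 0 < W⁻¹ • x := by
        rw [← smul_lt_smul W, smul_inv_smul]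
        exact hx.2
      have h2 : W⁻¹ • x < 2 := by
        rw [← smul_lt_smul W, smul_inv_smul, hw]
        exact hxq
      rw [ha _ h0.le h2.le]
      intro h3
      linarith
    have h4 : ((b⁻¹ * c * b) * (W * a * W⁻¹)) • x = (b⁻¹ * c * b) • x := by
      rw [← h.eq, mul_smul _ (b⁻¹ * c * b)]
      exact hX _ hx.1.le
    rw [mul_smul _ (W * a * W⁻¹)] at h4
    exact hmove (smul_left_cancel _ h4)
  · intro hqe
    refine commute_of_forall_smul_eq (X := ℝ) fun x => ?_
    rcases le_total q x with hx | hx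
    · exact Or.inl (hX x hx)
    · right
      rw [mul_smul, mul_smul, inv_smul_eq_iff]
      refine hc _ ?_
      have h1 : b • (e - 1) = e := by
        rw [hb _ (by linarith) (by linarith), min_eq_right (by linarith)]
        ring
      rw [← h1, smul_le_smul]
      exact hx.trans hqe

/-- The word `w` maps `2` to `q` whenever it is evaluated at maps which agree on `[0, 2]` with the
first two generators. -/
def MapsTwoTo (w : FreeGroup (Fin 2)) (q : ℝ) : Prop :=
  ∀ A B : HomeoPlus, (∀ x : ℝ, 0 ≤ x → x ≤ 2 → A • x = x / 2 + 1) →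
    (∀ x : ℝ, 0 ≤ x → x ≤ 1 → B • x = 2 * x) → FreeGroup.lift ![A, B] w • (2 : ℝ) = q

/-- The relations of `a, b, c` encode the real number `e`. -/
def Encodes {G : Type*} [Group G] (e : ℝ) (a b c : G) : Prop :=
  ∀ w q, MapsTwoTo w q → q < 2 → (CommRel a b c w ↔ q ≤ e - 1)

theorem exists_encodes {n : ℕ} (hn : 3 ≤ n) {e : ℝ} (he : e ∈ Set.Ioo 2 3) :
    ∃ a b c : commutator (bumpChainGroup n e), Encodes e a b c := by
  obtain ⟨a, b, c, h1, h2, h3, h4, h5⟩ := exists_commutator_eq_chainGen hn he.1 he.2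
  refine ⟨a, b, c, fun w q hw hq => ?_⟩
  have hinj : Function.Injective ((bumpChainGroup n e).subtype.comp
      (commutator (bumpChainGroup n e)).subtype) :=
    (Subgroup.subtype_injective _).comp (Subgroup.subtype_injective _)
  rw [← commRel_map_iff hinj]
  refine commRel_iff he.1 he.2 h1 h2 h3 h4 h5 (hw _ _ h1 fun x hx hx' => ?_) hq
  exact (h3 x hx (by linarith)).trans (min_eq_left (by linarith))

theorem Encodes.map {G H : Type*} [Group G] [Group H] {e : ℝ} {a b c : G} (h : Encodes e a b c)
    (φ : G ≃* H) : Encodes e (φ a) (φ b) (φ c) := fun w q hw hq =>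
  (commRel_map_iff (φ := φ.toMonoidHom) φ.injective a b c w).trans (h w q hw hq)

/-- A dyadic q strictly between e - 1 and e' - 1 would give contradictory verdicts on one relation.
-/
theorem Encodes.le {G : Type*} [Group G] {e e' : ℝ} (he : 2 < e) (he' : e' < 3) {a b c : G}
    (h : Encodes e a b c) (h' : Encodes e' a b c) : e' ≤ e := by
  by_contra! hlt
  obtain ⟨w, q, hq, hq', hw⟩ := exists_freeGroup_smul_mem_Ioo (u := e - 1) (v := e' - 1)
    (by linarith) (by linarith) (by linarith)
  have h1 := (h' w q hw (by linarith)).mpr hq'.le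
  exact absurd ((h w q hw (by linarith)).mp h1) hq.not_ge

/-! ### Counting isomorphism classes. -/

theorem countable_setOf_mulEquiv_commutator {n : ℕ} (hn : 3 ≤ n) (Γ : Type*) [Group Γ]
    [Countable Γ] :
    {e ∈ Set.Ioo (2 : ℝ) 3 | Nonempty (commutator (bumpChainGroup n e) ≃* Γ)}.Countable := by
  have hex : ∀ e ∈ {e ∈ Set.Ioo (2 : ℝ) 3 | Nonempty (commutator (bumpChainGroup n e) ≃* Γ)},
      ∃ t : Γ × Γ × Γ, Encodes e t.1 t.2.1 t.2.2 := by
    rintro e ⟨he, ⟨φ⟩⟩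
    obtain ⟨a, b, c, h⟩ := exists_encodes hn he
    exact ⟨(φ a, φ b, φ c), h.map φ⟩
  choose! F hF using hex
  -- A triple of elements of Γ encodes at most one e in (2, 3), so these parameters inject into Γ³.
  refine Set.MapsTo.countable_of_injOn (Set.mapsTo_univ F _) ?_ Set.countable_univ
  intro e he e' he' hee
  have h := hF e he
  have h' := hF e' he'
  rw [← hee] at h'
  exact le_antisymm (h'.le he'.1.1 he.1.2 h) (h.le he.1.1 he'.1.2 h')

instance (n : ℕ) (e : ℝ) : Countable (bumpChainGroup n e) := by
  rw [bumpChainGroup, ← FreeGroup.range_lift_eq_closure]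
  exact (FreeGroup.lift fun i : Fin n => chainGen e i).rangeRestrict_surjective.countable

theorem nonempty_commutator_mulEquiv {G H : Type*} [Group G] [Group H] (φ : G ≃* H) :
    Nonempty (commutator G ≃* commutator H) := by
  have h : (commutator G).map φ.toMonoidHom = commutator H := by
    rw [commutator_def, commutator_def, Subgroup.map_commutator,
      Subgroup.map_top_of_surjective _ φ.surjective]
  exact ⟨(φ.subgroupMap (commutator G)).trans (MulEquiv.subgroupCongr h)⟩

/-- There are countably many finite presentations, and the commutator subgroup of each presented
group is countable, hence accounts for countably many e. -/
theorem countable_setOf_isFinitelyPresented {n : ℕ} (hn : 3 ≤ n) :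
    {e ∈ Set.Ioo (2 : ℝ) 3 | Group.IsFinitelyPresented (bumpChainGroup n e)}.Countable := by
  have hsub : {e ∈ Set.Ioo (2 : ℝ) 3 | Group.IsFinitelyPresented (bumpChainGroup n e)} ⊆
      ⋃ c : Σ k : ℕ, Finset (FreeGroup (Fin k)), {e ∈ Set.Ioo (2 : ℝ) 3 |
        Nonempty (commutator (bumpChainGroup n e) ≃*
          commutator (FreeGroup (Fin c.1) ⧸ Subgroup.normalClosure (c.2 : Set _)))} := by
    rintro e ⟨he, ⟨k, φ, hφ, S, hS, hker⟩⟩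
    refine Set.mem_iUnion.mpr ⟨⟨k, hS.toFinset⟩, he, ?_⟩
    rw [hS.coe_toFinset]
    exact nonempty_commutator_mulEquiv ((QuotientGroup.quotientMulEquivOfEq hker).trans
      (QuotientGroup.quotientKerEquivOfSurjective φ hφ)).symm
  refine Set.Countable.mono hsub (Set.countable_iUnion fun c => ?_)
  have : Countable (FreeGroup (Fin c.1) ⧸ Subgroup.normalClosure (c.2 : Set _)) :=
    Quotient.countable
  exact countable_setOf_mulEquiv_commutator hn _

end HomeoPlus

open HomeoPlus in
theorem mainTheorem4 (n : ℕ) (hn : 3 ≤ n) :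
    ∃ 𝒢 : Set (Subgroup ChainGroups.HomeoPlus),
      ¬ 𝒢.Countable ∧
      (∀ G ∈ 𝒢, ChainGroups.IsChainGroup n G ∧
        ¬ Group.IsFinitelyPresented G ∧ IsSimpleGroup (commutator G)) ∧
      ∀ G ∈ 𝒢, ∀ H ∈ 𝒢, G ≠ H → IsEmpty (commutator G ≃* commutator H) := by
  set S := {e ∈ Set.Ioo (2 : ℝ) 3 | ¬ Group.IsFinitelyPresented (bumpChainGroup n e)} with hS
  -- One parameter is kept for each isomorphism class of commutator subgroups.
  let r : Setoid S :=
    { r := fun e e' => Nonempty (commutator (bumpChainGroup n e) ≃*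
        commutator (bumpChainGroup n e'))
      iseqv := ⟨fun _ => ⟨MulEquiv.refl _⟩, fun ⟨φ⟩ => ⟨φ.symm⟩, fun ⟨φ⟩ ⟨ψ⟩ => ⟨φ.trans ψ⟩⟩ }
  have hiso : ∀ q q' : Quotient r, Nonempty (commutator (bumpChainGroup n (q.out : S)) ≃*
      commutator (bumpChainGroup n (q'.out : S))) → q = q' := fun q q' h =>
    Quotient.out_equiv_out.mp h
  have hout : ∀ e : S, Nonempty (commutator (bumpChainGroup n e) ≃*
      commutator (bumpChainGroup n ((Quotient.mk r e).out : S))) := fun e => by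
    have h : r e (Quotient.mk r e).out := r.symm (Quotient.mk_out e)
    exact h
  refine ⟨Set.range fun q : Quotient r => bumpChainGroup n (q.out : S), fun hcount => ?_, ?_, ?_⟩
  · have hinj : Function.Injective fun q : Quotient r => bumpChainGroup n (q.out : S) := by
      intro q q' h
      refine hiso q q' ?_
      dsimp only at h
      rw [h]
      exact ⟨MulEquiv.refl _⟩
    have hQ : Countable (Quotient r) := by
      have := hcount.to_subtype
      exact (Set.rangeFactorization_injective.mpr hinj).countable
    -- With countably many classes, (2, 3) would be a countable union of countable sets.
    have hsub : Set.Ioo (2 : ℝ) 3 ⊆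
        {e ∈ Set.Ioo (2 : ℝ) 3 | Group.IsFinitelyPresented (bumpChainGroup n e)} ∪
        ⋃ q : Quotient r, {e ∈ Set.Ioo (2 : ℝ) 3 | Nonempty (commutator (bumpChainGroup n e) ≃*
          commutator (bumpChainGroup n (q.out : S)))} := by
      intro e he
      by_cases hfp : Group.IsFinitelyPresented (bumpChainGroup n e)
      · exact Or.inl ⟨he, hfp⟩
      · refine Or.inr (Set.mem_iUnion.mpr ⟨Quotient.mk r ⟨e, he, hfp⟩, he, ?_⟩)
        exact hout ⟨e, he, hfp⟩
    have hIoo : (Set.Ioo (2 : ℝ) 3).Countable :=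
      ((countable_setOf_isFinitelyPresented hn).union (Set.countable_iUnion fun q =>
        countable_setOf_mulEquiv_commutator hn _)).mono hsub
    exact (Cardinal.Real.Ioo_countable_iff.mp hIoo).not_gt (by norm_num)
  · rintro _ ⟨q, rfl⟩
    have he := (q.out : S).2
    exact ⟨isChainGroup_bumpChainGroup (by omega) he.1.1.le, he.2,
      isSimpleGroup_commutator_bumpChainGroup (by omega) he.1.1.le⟩
  · rintro _ ⟨q, rfl⟩ _ ⟨q', rfl⟩ hne
    by_contra hc
    rw [not_isEmpty_iff] at hc
    exact hne (by rw [hiso q q' hc])
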